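/- Let $d\in\mathbb{N}$, let $x\sim\mathcal N(0,I_d)$, and write $\mathbb E_x$ for the expectation over $x$. Let $V\subset\mathbb R^d$ be a subspace and $f^*(x)=h^*(x_V)$, where $x_V$ is the orthogonal projection of $x$ onto $V$ and $h^*:V\to\mathbb R$ is a polynomial map. For $\theta=(a,w)\in\mathbb R\times\mathbb R^d$ and a probability measure $\rho$ on $\mathbb R^{d+1}$ put $$f_{\mathrm{NN}}(x;\rho)=\int a\,\sigma(w^\top x)\,\rho(da,dw),\qquad \Phi(\theta;\rho)=a\,\mathbb E_x\big[(f_{\mathrm{NN}}(x;\rho)-f^*(x))\,\sigma(w^\top x)\big].$$ Assume, for some constants $K_\sigma,K_\xi,K_\rho>0$: (i) $\sigma:\mathbb R\to\mathbb R$ is twice continuously differentiable and $|\sigma|,|\sigma'|,|\sigma''|\le K_\sigma$ everywhere; (ii) $\xi_a,\xi_w:[0,\infty)\to[0,K_\xi]$ are Lipschitz continuous with $\int_0^\infty\xi_a(t)\,dt=\int_0^\infty\xi_w(t)\,dt=+\infty$; (iii) $\rho_0=\rho_a\times\rho_w$, where $\rho_a$ is a symmetric probability measure on $\mathbb R$ supported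 in $[-K_\rho,K_\rho]$ and $\rho_w$ is a probability measure on $\mathbb R^d$. Let $(\rho_t)_{t\ge0}$ be a weak solution of the mean-field flow $$\partial_t\rho_t=\nabla_\theta\cdot\big(\rho_t\,\xi(t)\nabla_\theta\Phi(\theta;\rho_t)\big),\qquad \rho_t|_{t=0}=\rho_0,\qquad \xi(t)=\mathrm{diag}(\xi_a(t),\xi_w(t)I_d),$$ that is, a narrowly continuous curve of probability measures on $\mathbb R^{d+1}$ that starts at $\rho_0$, satisfies $\int_0^T\!\int|a|\,\rho_t(da,dw)\,dt<\infty$ for every $T>0$, and $$\int_0^\infty\!\!\int\big(-\partial_t\eta+\nabla_\theta\eta\cdot(\xi(t)\nabla_\theta\Phi(\theta;\rho_t))\big)\,\rho_t(d\theta)\,dt=0\qquad\text{for all }\eta\in C_c^\infty(\mathbb R^{d+1}\times(0,\infty)).$$ Let $S\subset\mathbb R^d$ be a subspace, let $x_S$ and $w_S$ be the orthogonal projections of $x$ and $w$ onto $S$, let $x_S^\perp=x-x_S$, let $\mathcal P_S:\mathbb R^{d+1}\to S$ be the map $(a,w)\mapsto w_S$, and let $\delta_S$ be the Dirac measure at $0$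 on $S$. If $(\mathcal P_S)_\#\rho_0=\delta_S$ and $$\mathbb E_x\big[f^*(x)\,\sigma'(w^\top x_S^\perp)\,x_S\big]=0\qquad\text{for all }w\in\mathbb R^d,$$ then $(\mathcal P_S)_\#\rho_t=\delta_S$ for all $t\ge0$. -/

import Mathlib

open MeasureTheory ProbabilityTheory Set
open scoped NNReal ContDiff

noncomputable section

/-- The input space `ℝ^d` with its Euclidean structure. -/
abbrev Inp (d : ℕ) : Type := EuclideanSpace ℝ (Fin d)

/-- The parameter space `ℝ^{d+1}` of a neuron `θ = (a, w)`. -/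
abbrev Param (d : ℕ) : Type := ℝ × Inp d

/-- A polynomial map on a subspace `V` of `ℝ^d`. A linear form on `V` extends to `ℝ^d`, so these are
exactly the restrictions to `V` of polynomials in the coordinates of `ℝ^d`. -/
def IsPolynomialMap {d : ℕ} (V : Submodule ℝ (Inp d)) (h : V → ℝ) : Prop :=
  ∃ p : MvPolynomial (Fin d) ℝ, ∀ z : V, h z = MvPolynomial.eval (fun i => (z : Inp d) i) p

/-- The target function is a subspace-sparse polynomial: `f(x) = h(x_V)`, where `x_V` is the
orthogonal projection of `x` onto `V` and `h` is a polynomial map on `V`. -/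
def IsSubspaceSparsePolynomial {d : ℕ} (V : Submodule ℝ (Inp d)) (f : Inp d → ℝ) : Prop :=
  ∃ h : V → ℝ, IsPolynomialMap V h ∧ ∀ x, f x = h (V.orthogonalProjectionOnto x)

/-- The activation is `C²`, and it and its first two derivatives are bounded by `K`. -/
structure ActivationAssumption (σ : ℝ → ℝ) (K : ℝ) : Prop where
  contDiff : ContDiff ℝ 2 σ
  bound : ∀ u, |σ u| ≤ K
  bound_deriv : ∀ u, |deriv σ u| ≤ K
  bound_deriv2 : ∀ u, |deriv (deriv σ) u| ≤ K

/-- A learning rate on `[0, ∞)`: nonnegative, bounded by `K`, Lipschitz, of infinite integral.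
Its values at negative times play no role. -/
structure LearningRateAssumption (ξ : ℝ → ℝ) (K : ℝ) : Prop where
  nonneg : ∀ t, 0 ≤ t → 0 ≤ ξ t
  bound : ∀ t, 0 ≤ t → ξ t ≤ K
  lipschitz : ∃ L : ℝ≥0, LipschitzOnWith L ξ (Ici 0)
  integral_eq_top : ∫⁻ t in Ici (0 : ℝ), ENNReal.ofReal (ξ t) = ⊤

/-- The initial law is a product `ρ_a × ρ_w` of probability measures, with `ρ_a` symmetric and
supported in `[-K, K]`. -/
def InitialAssumption {d : ℕ} (ρ₀ : Measure (Param d)) (K : ℝ) : Prop :=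
  ∃ (ρa : Measure ℝ) (ρw : Measure (Inp d)),
    IsProbabilityMeasure ρa ∧ IsProbabilityMeasure ρw ∧ ρ₀ = ρa.prod ρw ∧
      ρa.map (fun a => -a) = ρa ∧ ρa (Icc (-K) K)ᶜ = 0

/-- The infinite-width network `f_NN(x; ρ) = ∫ a σ(wᵀx) ρ(da, dw)`. -/
def fNN {d : ℕ} (σ : ℝ → ℝ) (ρ : Measure (Param d)) (x : Inp d) : ℝ :=
  ∫ θ, θ.1 * σ (inner ℝ θ.2 x) ∂ρ

/-- `Φ(θ; ρ) = a 𝔼_x[(f_NN(x; ρ) - f(x)) σ(wᵀx)]` for `θ = (a, w)` and `x ∼ N(0, I_d)`. -/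
def Phi {d : ℕ} (σ : ℝ → ℝ) (f : Inp d → ℝ) (ρ : Measure (Param d)) (θ : Param d) : ℝ :=
  θ.1 * ∫ x, (fNN σ ρ x - f x) * σ (inner ℝ θ.2 x) ∂(stdGaussian (Inp d))

/-- The partial derivative in `a` of a function of `θ = (a, w)`. -/
def derivA {d : ℕ} (F : Param d → ℝ) (θ : Param d) : ℝ :=
  deriv (fun a => F (a, θ.2)) θ.1

/-- The partial gradient in `w` of a function of `θ = (a, w)`. -/
def gradW {d : ℕ} (F : Param d → ℝ) (θ : Param d) : Inp d :=
  gradient (fun w => F (θ.1, w)) θ.2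

/-- Smooth test functions of `(θ, t)` with compact support in `ℝ^{d+1} × (0, ∞)`. -/
structure IsTestFunction {d : ℕ} (η : Param d × ℝ → ℝ) : Prop where
  smooth : ContDiff ℝ ∞ η
  compact : HasCompactSupport η
  support : tsupport η ⊆ {q | 0 < q.2}

/-- `ρ` is a weak solution of
`∂_t ρ_t = ∇_θ · (ρ_t ξ(t) ∇_θ Φ(θ; ρ_t))` on `[0, ∞)` with initial value `ρ₀`, where
`ξ(t) = diag(ξa(t), ξw(t) I_d)`: a narrowly continuous curve of probability measures (the topology of
`ProbabilityMeasure` is that of weak convergence) that starts at `ρ₀` and satisfies the equation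
against all test functions. The condition `integrable` says that the coordinate `a` is integrable
for `ρ_t(dθ) dt` on bounded time intervals; it makes `f_NN(·; ρ_t)`, and with it the integrals in
the weak equation, absolutely convergent. -/
structure IsMeanFieldSolution {d : ℕ} (σ : ℝ → ℝ) (f : Inp d → ℝ) (ξa ξw : ℝ → ℝ)
    (ρ₀ : Measure (Param d)) (ρ : ℝ → ProbabilityMeasure (Param d)) : Prop where
  initial : (ρ 0 : Measure (Param d)) = ρ₀
  continuousOn : ContinuousOn ρ (Ici 0)
  integrable : ∀ T : ℝ, ∫⁻ t in Ioc 0 T, ∫⁻ θ, ‖θ.1‖ₑ ∂(ρ t : Measure (Param d)) < ⊤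
  weak : ∀ η : Param d × ℝ → ℝ, IsTestFunction η →
    ∫ t in Ioi (0 : ℝ), ∫ θ,
      (-deriv (fun s => η (θ, s)) t
        + (ξa t * (derivA (fun θ' => η (θ', t)) θ * derivA (Phi σ f (ρ t)) θ)
          + ξw t * inner ℝ (gradW (fun θ' => η (θ', t)) θ) (gradW (Phi σ f (ρ t)) θ)))
      ∂(ρ t : Measure (Param d)) = 0

/-- The map `(a, w) ↦ w_S` from `ℝ^{d+1}` to `S`. -/
def projS {d : ℕ} (S : Submodule ℝ (Inp d)) (θ : Param d) : S :=
  S.orthogonalProjectionOnto θ.2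

end

/-! Along $S$ the velocity of a neuron is governed by $\langle w_S,\nabla_w\Phi\rangle = a\,\mathbb
E_x[(f_{NN}-f)(x)\,\sigma'(w^\top x)\,\langle w_S,x\rangle]$. Replace $x$ by $x_S^\perp$ in the
arguments of $f_{NN}$ and $\sigma'$. The network part then has mean zero, being odd under
$x_S\mapsto -x_S$, and the target part has mean zero by hypothesis. What was discarded is small:
$\sigma'$ is Lipschitz, which costs $\|w_S\|$, and the network changes by at most a multiple of
$m=\int\min(1,\|w_S\|)\,d\rho_t$. If $|a|\le R$ holds $\rho_t$-almost surely, the result is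
$|\langle w_S,\nabla_w\Phi\rangle|\le |a|\,C(\|w_S\|^2+\|w_S\|\,m)$; this is
`abs_inner_meanResidualGrad_le`.

A Grönwall argument for $F(t)=\int \|w_S\|^2/(1+\|w_S\|^2)\,d\rho_t$ then gives $F\equiv 0$, since
$m^2\le 2F$ and $F(0)=0$; this is `ae_projS_eq_zero`. The square is saturated because no moment of
$w$ is assumed, so only bounded observables are available.

Everything is done on the weak equation, without characteristics or uniqueness. The velocity is
bounded only by a function $B(t)$ that is locally integrable in time, times $|a|$ in the $w$
component. Hence weak differentiation is carried out for absolutely continuous functions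
(`sub_eq_neg_integral_of_weak_deriv`), and test functions are extended from compact support to
boundedness in $w$ by cutoffs (`abs_integral_sub_integral_le`).

The bound $|a|\le R$ on bounded time intervals also has to come from the weak equation
(`exists_ae_abs_fst_le`). Grönwall for $\int e^{-n u(a)}\,d\rho_t$, with $u$ a wide 1-Lipschitz
bump, shows that the mass far out is at most $e^{1-n}$ for every $n$. -/

/-! ### Weak derivatives on the half-line and Grönwall's inequality. -/

open Filter Topology in
/-- Du Bois-Reymond: a continuous function with vanishing weak derivative on `(0, ∞)` is constant. -/
theorem eq_const_of_forall_integral_deriv_mul_eq_zero {I : ℝ → ℝ} (hI : Continuous I)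
    (h : ∀ p : ℝ → ℝ, ContDiff ℝ ∞ p → HasCompactSupport p → tsupport p ⊆ Ioi 0 →
      ∫ t, deriv p t * I t = 0) :
    ∃ c, ∀ t, 0 ≤ t → I t = c := by
  let b : ContDiffBump (1 : ℝ) := ⟨1 / 4, 1 / 2, by norm_num, by norm_num⟩
  set φ₀ : ℝ → ℝ := b.normed volume with hφ₀
  have hφ₀s : ContDiff ℝ ∞ φ₀ := b.contDiff_normed
  have hφ₀c : HasCompactSupport φ₀ := b.hasCompactSupport_normed
  have hφ₀t : tsupport φ₀ ⊆ Ioi 0 := by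
    rw [hφ₀, b.tsupport_normed_eq]
    intro x hx
    rw [Metric.mem_closedBall, Real.dist_eq, abs_le] at hx
    have h2 : -(1 / 2 : ℝ) ≤ x - 1 := hx.1
    simp only [mem_Ioi]; linarith
  have hφ₀i : ∫ x, φ₀ x = 1 := b.integral_normed
  refine ⟨∫ x, φ₀ x * I x, ?_⟩
  have key : ∀ᵐ x : ℝ, x ∈ Ioi (0 : ℝ) → I x - ∫ x, φ₀ x * I x = 0 := by
    refine isOpen_Ioi.ae_eq_zero_of_integral_contDiff_smul_eq_zero
      ((hI.sub continuous_const).locallyIntegrable.locallyIntegrableOn _) ?_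
    intro φ hφs hφc hφt
    set m := ∫ x, φ x
    -- Subtracting `m * φ₀` makes the mean zero, so the primitive taken from the left end of the
    -- support is again compactly supported and can be used in `h`.
    set q : ℝ → ℝ := fun x => φ x - m * φ₀ x with hq
    have hqs : ContDiff ℝ ∞ q := hφs.sub (contDiff_const.mul hφ₀s)
    have hqsupp : tsupport q ⊆ tsupport φ ∪ tsupport φ₀ := by
      refine closure_minimal ?_ ((isClosed_tsupport _).union (isClosed_tsupport _))
      intro x hx
      by_contra hcon
      simp only [mem_union, not_or] at hcon
      apply hx
      simp [hq, image_eq_zero_of_notMem_tsupport hcon.1, image_eq_zero_of_notMem_tsupport hcon.2]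
    have hφi : Integrable φ := hφs.continuous.integrable_of_hasCompactSupport hφc
    have hφ₀int : Integrable φ₀ := hφ₀s.continuous.integrable_of_hasCompactSupport hφ₀c
    have hqi : Integrable q := hφi.sub (hφ₀int.const_mul m)
    have hq0 : ∫ x, q x = 0 := by
      rw [hq, integral_sub hφi (hφ₀int.const_mul m), integral_const_mul, hφ₀i]; simp [m]
    have hK : IsCompact (tsupport φ ∪ tsupport φ₀) := IsCompact.union hφc hφ₀c
    have hKpos : tsupport φ ∪ tsupport φ₀ ⊆ Ioi 0 := union_subset hφt hφ₀t
    obtain ⟨e, he, hKe⟩ : ∃ e, 0 < e ∧ tsupport φ ∪ tsupport φ₀ ⊆ Ici e := by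
      rcases (tsupport φ ∪ tsupport φ₀).eq_empty_or_nonempty with h0 | h0
      · exact ⟨1, one_pos, by simp [h0]⟩
      · obtain ⟨e, heK, hmin⟩ := hK.exists_isMinOn h0 continuous_id.continuousOn
        exact ⟨e, hKpos heK, fun x hx => hmin hx⟩
    obtain ⟨T, hKT⟩ : ∃ T, tsupport φ ∪ tsupport φ₀ ⊆ Iic T := hK.bddAbove
    have hout : ∀ x, x ∉ Icc e T → q x = 0 := by
      intro x hx
      refine image_eq_zero_of_notMem_tsupport fun hx' => hx ?_
      exact ⟨hKe (hqsupp hx'), hKT (hqsupp hx')⟩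
    set p : ℝ → ℝ := fun x => ∫ y in e..x, q y with hp
    have hpd : ∀ x, HasDerivAt p (q x) x := fun x =>
      intervalIntegral.integral_hasDerivAt_right
        (hqs.continuous.intervalIntegrable _ _)
        (hqs.continuous.stronglyMeasurableAtFilter _ _) hqs.continuous.continuousAt
    have hpderiv : deriv p = q := funext fun x => (hpd x).deriv
    have hps : ContDiff ℝ ∞ p :=
      contDiff_infty_iff_deriv.2 ⟨fun x => (hpd x).differentiableAt, hpderiv ▸ hqs⟩
    have hpout : ∀ x, x ∉ Icc e T → p x = 0 := by
      intro x hx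
      rw [mem_Icc, not_and_or, not_le, not_le] at hx
      rcases hx with hx | hx
      · refine (intervalIntegral.integral_congr_ae (ae_of_all _ fun y hy => ?_)).trans
          intervalIntegral.integral_zero
        · rw [uIoc_of_ge hx.le] at hy
          -- The half-open interval contains its end `e`, which `hout` does not cover; there `q`
          -- vanishes by continuity from the left.
          by_cases hye : y = e
          · subst hye
            have hlim : Tendsto q (𝓝[<] y) (𝓝 (q y)) :=
              hqs.continuous.continuousAt.continuousWithinAt.tendsto
            refine tendsto_nhds_unique hlim (tendsto_const_nhds.congr' ?_)
            filter_upwards [self_mem_nhdsWithin] with z hz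
            exact (hout z fun hz' => absurd hz'.1 (not_le.2 hz)).symm
          · exact hout y fun hy' => hye (le_antisymm hy.2 hy'.1)
      · by_cases hex : e ≤ x
        · have : ∫ y in e..x, q y = ∫ y, q y := by
            rw [intervalIntegral.integral_of_le hex, ← integral_Icc_eq_integral_Ioc]
            refine setIntegral_eq_integral_of_forall_compl_eq_zero fun y hy => hout y fun hy' =>
              hy ⟨hy'.1, hy'.2.trans hx.le⟩
          rw [hp]; simp only [this, hq0]
        · push Not at hex
          have : ∀ y, q y = 0 := fun y => hout y fun hy' => by
            have := hy'.1.trans hy'.2; linarith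
          simp [hp, this]
    have hptsupp : tsupport p ⊆ Icc e T := closure_minimal
      (fun x hx => by_contra fun hx' => hx (hpout x hx')) isClosed_Icc
    have h0 := h p hps (isCompact_Icc.of_isClosed_subset (isClosed_tsupport _) hptsupp)
      (hptsupp.trans fun x hx => he.trans_le hx.1)
    rw [hpderiv] at h0
    have hφI : Integrable fun x => φ x * I x :=
      (hφs.continuous.mul hI).integrable_of_hasCompactSupport hφc.mul_right
    have hφ₀I : Integrable fun x => φ₀ x * I x :=
      (hφ₀s.continuous.mul hI).integrable_of_hasCompactSupport hφ₀c.mul_right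
    have e1 : ∫ x, q x * I x = (∫ x, φ x * I x) - m * ∫ x, φ₀ x * I x := by
      rw [← integral_const_mul, ← integral_sub hφI (hφ₀I.const_mul m)]
      congr 1; ext x; simp only [hq]; ring
    have e2 : ∫ x, φ x • (I x - ∫ x, φ₀ x * I x) = (∫ x, φ x * I x) - m * ∫ x, φ₀ x * I x := by
      rw [← integral_mul_const, ← integral_sub hφI (hφi.mul_const _)]
      congr 1; ext x; simp only [smul_eq_mul]; ring
    rw [e2, ← e1, h0]
  set c := ∫ x, φ₀ x * I x
  have hae : I =ᵐ[volume.restrict (Ioi 0)] fun _ => c := by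
    rw [EventuallyEq, ae_restrict_iff' measurableSet_Ioi]
    filter_upwards [key] with x hx hx0
    linarith [hx hx0]
  have hon := Measure.eqOn_open_of_ae_eq hae isOpen_Ioi hI.continuousOn continuousOn_const
  have hcl := hon.closure hI continuous_const
  rw [closure_Ioi] at hcl
  exact fun t ht => hcl ht

open Filter Topology in
/-- A continuous function `H` with locally integrable weak derivative `-G` on `(0, ∞)` satisfies the
fundamental theorem of calculus. -/
theorem sub_eq_neg_integral_of_weak_deriv {H G : ℝ → ℝ} (hH : Continuous H)
    (hG : ∀ T, IntegrableOn G (Ioc 0 T))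
    (h : ∀ p : ℝ → ℝ, ContDiff ℝ ∞ p → HasCompactSupport p → tsupport p ⊆ Ioi 0 →
      ∫ t in Ioi (0 : ℝ), (-(deriv p t * H t) + p t * G t) = 0)
    {s t : ℝ} (hs : 0 ≤ s) (hst : s ≤ t) :
    H t - H s = -∫ r in s..t, G r := by
  -- `G` is controlled only on positive times; truncation gives a primitive `J` on the whole line,
  -- and `H + J` is then weakly constant.
  set G' : ℝ → ℝ := (Ioi (0 : ℝ)).indicator G with hG'
  have hG'i : ∀ a b, IntervalIntegrable G' volume a b := by
    have : ∀ T, IntegrableOn G' (Iic T) := fun T => by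
      rw [hG', integrableOn_indicator_iff measurableSet_Ioi, Ioi_inter_Iic]
      exact hG T
    refine fun a b => ⟨(this b).mono_set Ioc_subset_Iic_self, (this a).mono_set Ioc_subset_Iic_self⟩
  set J : ℝ → ℝ := fun t => ∫ r in (0 : ℝ)..t, G' r with hJ
  have hJc : Continuous J := intervalIntegral.continuous_primitive hG'i 0
  obtain ⟨c, hc⟩ := eq_const_of_forall_integral_deriv_mul_eq_zero (hH.add hJc) fun p hp hpc hpt => by
    obtain ⟨T, hT0, hT⟩ : ∃ T, 0 < T ∧ tsupport p ⊆ Ioo 0 T := by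
      obtain ⟨T, hT⟩ := (show IsCompact (tsupport p) from hpc).bddAbove
      refine ⟨max T 0 + 1, by positivity, fun x hx => ⟨hpt hx, ?_⟩⟩
      have := hT hx
      have := le_max_left T 0
      linarith
    have hdT : tsupport (deriv p) ⊆ Ioo 0 T := (tsupport_deriv_subset ..).trans hT
    have hpd : Continuous (deriv p) := hp.continuous_deriv (by simp)
    have hpz : ∀ x, x ∉ Ioo 0 T → p x = 0 := fun x hx =>
      image_eq_zero_of_notMem_tsupport fun h' => hx (hT h')
    have hdz : ∀ x, x ∉ Ioo 0 T → deriv p x = 0 := fun x hx =>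
      image_eq_zero_of_notMem_tsupport fun h' => hx (hdT h')
    have e0 : ∀ f : ℝ → ℝ, ∫ t, deriv p t * f t = ∫ t in (0 : ℝ)..T, deriv p t * f t := fun f => by
      rw [intervalIntegral.integral_of_le hT0.le]
      exact (setIntegral_eq_integral_of_forall_compl_eq_zero fun y hy => by
        rw [hdz y fun hy' => hy ⟨hy'.1, hy'.2.le⟩, zero_mul]).symm
    have e1 := h p hp hpc hpt
    have e2 : ∫ t in Ioi (0 : ℝ), (-(deriv p t * H t) + p t * G t) =
        ∫ t in (0 : ℝ)..T, (-(deriv p t * H t) + p t * G' t) := by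
      rw [intervalIntegral.integral_of_le hT0.le]
      refine (setIntegral_eq_of_subset_of_forall_sdiff_eq_zero (s := Ioc 0 T) measurableSet_Ioi
        Ioc_subset_Ioi_self fun y hy => ?_).trans ?_
      · have : y ∉ Ioo 0 T := fun h' => hy.2 ⟨h'.1, h'.2.le⟩
        simp [hpz y this, hdz y this]
      · refine setIntegral_congr_fun measurableSet_Ioc fun y hy => ?_
        simp [hG', indicator_of_mem (show y ∈ Ioi (0 : ℝ) from hy.1)]
    -- `G` is merely integrable, so `J` is absolutely continuous with derivative `G'` almost
    -- everywhere; integration by parts must be taken in that class.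
    have hpac : AbsolutelyContinuousOnInterval p 0 T :=
      (hp.of_le (by simp)).contDiffOn.absolutelyContinuousOnInterval
    have hJac : AbsolutelyContinuousOnInterval J 0 T :=
      (hG'i 0 T).absolutelyContinuousOnInterval_intervalIntegral left_mem_uIcc
    have e3 := hpac.integral_mul_deriv_eq_deriv_mul hJac
    rw [hpz T (by simp), hpz 0 (by simp)] at e3
    have e4 : ∫ x in (0 : ℝ)..T, p x * deriv J x = ∫ x in (0 : ℝ)..T, p x * G' x := by
      refine intervalIntegral.integral_congr_ae ?_
      filter_upwards [(hG'i 0 T).ae_hasDerivAt_integral] with x hx hx'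
      rw [(hx (uIoc_subset_uIcc hx') 0 left_mem_uIcc).deriv]
    rw [e4] at e3
    have i1 : IntervalIntegrable (fun t => deriv p t * H t) volume 0 T :=
      (hpd.mul hH).intervalIntegrable _ _
    have i2 : IntervalIntegrable (fun t => deriv p t * J t) volume 0 T :=
      (hpd.mul hJc).intervalIntegrable _ _
    have i3 : IntervalIntegrable (fun t => p t * G' t) volume 0 T :=
      (hG'i 0 T).continuousOn_mul hp.continuous.continuousOn
    have i4 : IntervalIntegrable (fun t => -(deriv p t * H t)) volume 0 T := i1.neg
    rw [e2, intervalIntegral.integral_add i4 i3, intervalIntegral.integral_neg] at e1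
    rw [e0]
    simp only [Pi.add_apply, mul_add]
    rw [intervalIntegral.integral_add i1 i2]
    linarith
  have h1 := hc t (hs.trans hst)
  have h2 := hc s hs
  have h3 : J t - J s = ∫ r in s..t, G r := by
    rw [hJ]
    simp only
    rw [intervalIntegral.integral_interval_sub_left (hG'i _ _) (hG'i _ _)]
    refine intervalIntegral.integral_congr_ae (ae_of_all _ fun x hx => ?_)
    rw [uIoc_of_le hst] at hx
    exact indicator_of_mem (show x ∈ Ioi (0 : ℝ) from hs.trans_lt hx.1) _
  simp only [Pi.add_apply] at h1 h2
  linarith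

/-- Grönwall's inequality with an integrable coefficient, in a dyadic form. -/
theorem le_two_pow_mul_of_abs_sub_le_integral {F c : ℝ → ℝ} {T : ℝ} (hF : Continuous F) (hF0 : ∀ t, 0 ≤ F t)
    (hc0 : ∀ t, 0 ≤ c t) (hc : ∀ T, IntegrableOn c (Ioc 0 T))
    (h : ∀ s t, 0 ≤ s → s ≤ t → t ≤ T → |F t - F s| ≤ ∫ r in s..t, c r * F r) (N : ℕ) :
    ∀ a b, 0 ≤ a → a ≤ b → b ≤ T → ∫ r in a..b, c r ≤ N / 2 → F b ≤ 2 ^ N * F a := by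
  have hci : ∀ a b, 0 ≤ a → 0 ≤ b → IntervalIntegrable c volume a b := fun a b ha hb =>
    ⟨(hc b).mono_set (Ioc_subset_Ioc_left ha), (hc a).mono_set (Ioc_subset_Ioc_left hb)⟩
  -- At a maximum point `m`, `F m ≤ F a + F m / 2`; absorbing the last term gives the factor 2.
  have step : ∀ a b, 0 ≤ a → a ≤ b → b ≤ T → ∫ r in a..b, c r ≤ 1 / 2 → F b ≤ 2 * F a := by
    intro a b ha hab hbT hint
    obtain ⟨m, hm, hmax⟩ := isCompact_Icc.exists_isMaxOn (nonempty_Icc.2 hab) hF.continuousOn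
    have h1 : F m - F a ≤ ∫ r in a..m, c r * F r := (le_abs_self _).trans (h a m ha hm.1 (hm.2.trans hbT))
    have h2 : ∫ r in a..m, c r * F r ≤ ∫ r in a..m, c r * F m := by
      refine intervalIntegral.integral_mono_on hm.1
        ((hci a m ha (ha.trans hm.1)).mul_continuousOn hF.continuousOn)
        ((hci a m ha (ha.trans hm.1)).mul_const _) fun r hr => ?_
      exact mul_le_mul_of_nonneg_left (hmax ⟨hr.1, hr.2.trans hm.2⟩) (hc0 r)
    have h3 : ∫ r in a..m, c r ≤ 1 / 2 := by
      refine le_trans ?_ hint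
      rw [← intervalIntegral.integral_add_adjacent_intervals (hci a m ha (ha.trans hm.1))
        (hci m b (ha.trans hm.1) (ha.trans hab))]
      linarith [intervalIntegral.integral_nonneg (μ := volume) hm.2 fun r _ => hc0 r]
    rw [intervalIntegral.integral_mul_const] at h2
    have h4 : (∫ r in a..m, c r) * F m ≤ 1 / 2 * F m := mul_le_mul_of_nonneg_right h3 (hF0 m)
    have h5 : F b ≤ F m := hmax (right_mem_Icc.2 hab)
    linarith
  induction N with
  | zero =>
    intro a b ha hab hbT hint
    have h0 : ∫ r in a..b, c r * F r ≤ 0 := by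
      obtain ⟨m, hm, hmax⟩ := isCompact_Icc.exists_isMaxOn (nonempty_Icc.2 hab) hF.continuousOn
      have h2 : ∫ r in a..b, c r * F r ≤ ∫ r in a..b, c r * F m := by
        refine intervalIntegral.integral_mono_on hab
          ((hci a b ha (ha.trans hab)).mul_continuousOn hF.continuousOn)
          ((hci a b ha (ha.trans hab)).mul_const _) fun r hr => ?_
        exact mul_le_mul_of_nonneg_left (hmax hr) (hc0 r)
      rw [intervalIntegral.integral_mul_const] at h2
      refine h2.trans (mul_nonpos_of_nonpos_of_nonneg ?_ (hF0 m))
      simpa using hint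
    have := (le_abs_self _).trans (h a b ha hab hbT)
    simp only [pow_zero, one_mul]
    linarith
  | succ N ih =>
    intro a b ha hab hbT hint
    by_cases hsmall : ∫ r in a..b, c r ≤ 1 / 2
    · refine (step a b ha hab hbT hsmall).trans ?_
      rw [pow_succ']
      have : (1 : ℝ) ≤ 2 ^ N := one_le_pow₀ (by norm_num)
      nlinarith [hF0 a]
    · push Not at hsmall
      have hcont : ContinuousOn (fun x => ∫ r in a..x, c r) (Icc a b) := by
        have := intervalIntegral.continuousOn_primitive_interval (μ := volume) (f := c) (a := a)
          (b := b) (by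
            rw [uIcc_of_le hab, integrableOn_Icc_iff_integrableOn_Ioc]
            exact (hc b).mono_set (Ioc_subset_Ioc_left ha))
        rwa [uIcc_of_le hab] at this
      -- Split off an initial piece on which `c` has mass exactly 1/2; what remains has mass at most
      -- `N / 2`.
      obtain ⟨m, hm, hm'⟩ := intermediate_value_Icc hab hcont
        (show (1 / 2 : ℝ) ∈ Icc _ _ from ⟨by simp, hsmall.le⟩)
      simp only at hm'
      have hsplit := intervalIntegral.integral_add_adjacent_intervals
        (hci a m ha (ha.trans hm.1)) (hci m b (ha.trans hm.1) (ha.trans hab))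
      have h1 := step a m ha hm.1 (hm.2.trans hbT) hm'.le
      have h2 := ih m b (ha.trans hm.1) hm.2 hbT (by push_cast at hint; linarith)
      calc F b ≤ 2 ^ N * F m := h2
        _ ≤ 2 ^ N * (2 * F a) := by gcongr
        _ = 2 ^ (N + 1) * F a := by ring

/-! ### The continuity equation in weak form. -/

/-- A narrowly continuous curve of probability measures is measurable. -/
theorem measurable_toMeasure_of_continuous {X Ω : Type*} [TopologicalSpace X] [MeasurableSpace X]
    [OpensMeasurableSpace X] [TopologicalSpace Ω] [MeasurableSpace Ω] [BorelSpace Ω]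
    [HasOuterApproxClosed Ω] {ρ : X → ProbabilityMeasure Ω} (hρ : Continuous ρ) :
    Measurable fun x => (ρ x : Measure Ω) := by
  refine Measurable.measure_of_isPiSystem_of_isProbabilityMeasure
    (BorelSpace.measurable_eq (α := Ω)) isPiSystem_isOpen fun G hG => ?_
  -- By the portmanteau theorem the mass of an open set is lower semicontinuous along the curve.
  refine LowerSemicontinuous.measurable ?_
  rw [lowerSemicontinuous_iff_le_liminf]
  exact fun x => ProbabilityMeasure.le_liminf_measure_open_of_tendsto (hρ.tendsto x) hG

/-- Turns the two partial pairings of the weak equation into one Fréchet derivative, so that product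
and chain rules apply at once. -/
theorem derivA_mul_add_inner_gradW {d : ℕ} {h : Param d → ℝ} {θ : Param d}
    (hh : DifferentiableAt ℝ h θ) (x : ℝ) (v : Inp d) :
    derivA h θ * x + inner ℝ (gradW h θ) v = fderiv ℝ h θ (x, v) := by
  have h1 : HasDerivAt (fun a : ℝ => h (a, θ.2)) (fderiv ℝ h θ (1, 0)) θ.1 := by
    have := (show HasFDerivAt h (fderiv ℝ h θ) (θ.1, θ.2) from hh.hasFDerivAt).comp θ.1
      (hasFDerivAt_prodMk_left (𝕜 := ℝ) θ.1 θ.2)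
    simpa [Function.comp_def] using this.hasDerivAt
  have h2 : HasFDerivAt (fun w : Inp d => h (θ.1, w))
      ((fderiv ℝ h θ).comp (ContinuousLinearMap.inr ℝ ℝ (Inp d))) θ.2 :=
    (show HasFDerivAt h (fderiv ℝ h θ) (θ.1, θ.2) from hh.hasFDerivAt).comp θ.2
      (hasFDerivAt_prodMk_right (𝕜 := ℝ) θ.1 θ.2)
  have e1 : derivA h θ = fderiv ℝ h θ (1, 0) := h1.deriv
  have e2 : inner ℝ (gradW h θ) v = fderiv ℝ h θ (0, v) := by
    rw [gradW, gradient, h2.fderiv, InnerProductSpace.toDual_symm_apply]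
    simp
  rw [e1, e2, mul_comm, ← smul_eq_mul, ← map_smul, ← map_add]
  simp

/-- `ρ` solves the continuity equation with velocity field `-(α, β)` on positive times, where the
velocity is controlled by a locally integrable function of time. -/
structure IsTransportedBy {d : ℕ} (ρ : ℝ → ProbabilityMeasure (Param d))
    (α : ℝ → Param d → ℝ) (β : ℝ → Param d → Inp d) (B : ℝ → ℝ) : Prop where
  continuous : Continuous ρ
  measurable_left : Measurable (Function.uncurry α)
  measurable_right : Measurable (Function.uncurry β)
  integrableOn_bound : ∀ T, IntegrableOn B (Ioc 0 T)
  bound_nonneg : ∀ t, 0 ≤ B t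
  abs_fst_le : ∀ᵐ t ∂volume.restrict (Ioi (0 : ℝ)), ∀ θ, |α t θ| ≤ B t
  norm_snd_le : ∀ᵐ t ∂volume.restrict (Ioi (0 : ℝ)), ∀ θ, ‖β t θ‖ ≤ |θ.1| * B t
  weak : ∀ η : Param d × ℝ → ℝ, IsTestFunction η →
    ∫ t in Ioi (0 : ℝ), ∫ θ,
      (-deriv (fun s => η (θ, s)) t
        + (derivA (fun θ' => η (θ', t)) θ * α t θ
          + inner ℝ (gradW (fun θ' => η (θ', t)) θ) (β t θ)))
      ∂(ρ t : Measure (Param d)) = 0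

namespace IsTransportedBy

variable {d : ℕ} {ρ : ℝ → ProbabilityMeasure (Param d)} {α : ℝ → Param d → ℝ}
  {β : ℝ → Param d → Inp d} {B : ℝ → ℝ}

/-- The curve as a Markov kernel. -/
def kernel (hρ : IsTransportedBy ρ α β B) : Kernel ℝ (Param d) :=
  ⟨fun t => (ρ t : Measure (Param d)), measurable_toMeasure_of_continuous hρ.continuous⟩

instance (hρ : IsTransportedBy ρ α β B) : IsMarkovKernel hρ.kernel :=
  ⟨fun t => inferInstanceAs (IsProbabilityMeasure (ρ t : Measure (Param d)))⟩

theorem measurable_integral (hρ : IsTransportedBy ρ α β B) {f : ℝ → Param d → ℝ}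
    (hf : Measurable (Function.uncurry f)) :
    Measurable fun t => ∫ θ, f t θ ∂(ρ t : Measure (Param d)) :=
  (StronglyMeasurable.integral_kernel_prod_right (κ := hρ.kernel) hf.stronglyMeasurable).measurable

theorem continuous_integral (hρ : IsTransportedBy ρ α β B) {h : Param d → ℝ} (hh : Continuous h)
    {C : ℝ} (hC : ∀ θ, |h θ| ≤ C) : Continuous fun t => ∫ θ, h θ ∂(ρ t : Measure (Param d)) :=
  (ProbabilityMeasure.continuous_integral_boundedContinuousFunction
    (BoundedContinuousFunction.ofNormedAddCommGroup h hh C hC)).comp hρ.continuous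

theorem measurable_fderiv_apply (hρ : IsTransportedBy ρ α β B) {h : Param d → ℝ}
    (hh : ContDiff ℝ ∞ h) :
    Measurable (Function.uncurry fun t θ => fderiv ℝ h θ (α t θ, β t θ)) := by
  have h1 : Continuous fun q : Param d × Param d => fderiv ℝ h q.1 q.2 :=
    ((hh.continuous_fderiv (by simp)).comp continuous_fst).clm_apply continuous_snd
  exact h1.measurable.comp
    (measurable_snd.prodMk (hρ.measurable_left.prodMk hρ.measurable_right))

/-- The integrated continuity equation against a time-independent test function. -/
theorem integral_sub_integral (hρ : IsTransportedBy ρ α β B) {h : Param d → ℝ}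
    (hh : ContDiff ℝ ∞ h) (hc : HasCompactSupport h) {s t : ℝ} (hs : 0 ≤ s) (hst : s ≤ t) :
    (∫ θ, h θ ∂(ρ t : Measure (Param d))) - ∫ θ, h θ ∂(ρ s : Measure (Param d)) =
      -∫ r in s..t, ∫ θ, fderiv ℝ h θ (α r θ, β r θ) ∂(ρ r : Measure (Param d)) := by
  obtain ⟨C, hC⟩ := hh.continuous.bounded_above_of_compact_support hc
  obtain ⟨C', hC'⟩ := (hh.continuous_fderiv (by simp)).bounded_above_of_compact_support
    (hc.fderiv (𝕜 := ℝ))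
  obtain ⟨R, hR⟩ := (show IsCompact (tsupport h) from hc).isBounded.subset_closedBall 0
  have hC'0 : 0 ≤ C' := (norm_nonneg _).trans (hC' 0)
  -- Off the support of `h` the derivative vanishes; on it `|θ.1| ≤ |R|`, so both velocity
  -- components are at most `(1 + |R|) * B r`.
  have hbound : ∀ᵐ r ∂volume.restrict (Ioi (0 : ℝ)), ∀ θ,
      ‖fderiv ℝ h θ (α r θ, β r θ)‖ ≤ C' * ((1 + |R|) * B r) := by
    filter_upwards [hρ.abs_fst_le, hρ.norm_snd_le] with r h1 h2 θ
    by_cases hθ : θ ∈ tsupport h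
    · have h3 : ‖θ‖ ≤ R := by simpa using hR hθ
      have h4 : |θ.1| ≤ |R| := (norm_fst_le θ).trans (h3.trans (le_abs_self R))
      refine (ContinuousLinearMap.le_opNorm _ _).trans
        (mul_le_mul (hC' θ) ?_ (norm_nonneg _) hC'0)
      rw [Prod.norm_def]
      have hB := hρ.bound_nonneg r
      refine max_le ((h1 θ).trans ?_) ((h2 θ).trans ?_)
      · nlinarith [abs_nonneg R]
      · exact mul_le_mul_of_nonneg_right (by linarith) hB
    · have : fderiv ℝ h θ = 0 := image_eq_zero_of_notMem_tsupport
        fun h' => hθ (tsupport_fderiv_subset ℝ h')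
      rw [this]
      simp only [zero_apply, norm_zero]
      have := hρ.bound_nonneg r
      positivity
  have hmeas := hρ.measurable_fderiv_apply hh
  refine sub_eq_neg_integral_of_weak_deriv (H := fun t => ∫ θ, h θ ∂(ρ t : Measure (Param d)))
    (hρ.continuous_integral hh.continuous hC) (fun T => ?_) (fun p hp hpc hpt => ?_) hs hst
  · refine Integrable.mono' (((hρ.integrableOn_bound T).const_mul (1 + |R|)).const_mul C')
      (hρ.measurable_integral hmeas).aestronglyMeasurable ?_
    filter_upwards [ae_restrict_of_ae_restrict_of_subset Ioc_subset_Ioi_self hbound] with r hr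
    refine (norm_integral_le_of_norm_le (integrable_const _) (ae_of_all _ hr)).trans ?_
    simp
  -- Testing with a tensor product turns the equation into the weak derivative in time of the
  -- integral of `h`.
  · have htest : IsTestFunction (fun q : Param d × ℝ => h q.1 * p q.2) := by
      refine ⟨(hh.comp contDiff_fst).mul (hp.comp contDiff_snd), ?_, ?_⟩
      · refine HasCompactSupport.of_support_subset_isCompact
          (IsCompact.prod (show IsCompact (tsupport h) from hc)
            (show IsCompact (tsupport p) from hpc)) fun q hq => ?_
        exact ⟨subset_tsupport _ (left_ne_zero_of_mul hq),
          subset_tsupport _ (right_ne_zero_of_mul hq)⟩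
      · have : tsupport (fun q : Param d × ℝ => h q.1 * p q.2) ⊆ Prod.snd ⁻¹' tsupport p :=
          closure_minimal (fun q hq => subset_tsupport p (right_ne_zero_of_mul hq))
            ((isClosed_tsupport p).preimage continuous_snd)
        exact fun q hq => hpt (this hq)
    refine Eq.trans (Eq.symm (setIntegral_congr_ae measurableSet_Ioi ?_)) (hρ.weak _ htest)
    rw [ae_restrict_iff' measurableSet_Ioi] at hbound
    filter_upwards [hbound] with r hr hr0
    have hhi : Integrable h (ρ r : Measure (Param d)) :=
      Integrable.of_bound hh.continuous.aestronglyMeasurable C (ae_of_all _ hC)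
    have hfi : Integrable (fun θ => fderiv ℝ h θ (α r θ, β r θ)) (ρ r : Measure (Param d)) :=
      Integrable.of_bound (hmeas.comp measurable_prodMk_left).aestronglyMeasurable _
        (ae_of_all _ (hr hr0))
    have : ∀ θ, (-deriv (fun s => h θ * p s) r
        + (derivA (fun θ' => h θ' * p r) θ * α r θ
          + inner ℝ (gradW (fun θ' => h θ' * p r) θ) (β r θ))) =
        -(deriv p r) * h θ + p r * fderiv ℝ h θ (α r θ, β r θ) := by
      intro θ
      have hd : DifferentiableAt ℝ h θ := hh.differentiable (by simp) θ
      rw [derivA_mul_add_inner_gradW (hd.mul_const _), fderiv_mul_const hd, deriv_const_mul_field]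
      simp only [_root_.smul_apply, smul_eq_mul]
      ring
    simp only [this]
    rw [integral_add (hhi.const_mul _) (hfi.const_mul _), integral_const_mul, integral_const_mul]
    ring

open Filter Topology in
/-- Test functions compactly supported in the coordinate `a` and bounded in `w` are admissible. -/
theorem abs_integral_sub_integral_le (hρ : IsTransportedBy ρ α β B) {h : Param d → ℝ}
    (hh : ContDiff ℝ ∞ h) {C R : ℝ} (hC : ∀ θ, |h θ| ≤ C) (hR : ∀ θ : Param d, R < |θ.1| → h θ = 0)
    {s t : ℝ} (hs : 0 ≤ s) (hst : s ≤ t)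
    {g : ℝ → Param d → ℝ} {G : ℝ → ℝ} (hG : IntegrableOn G (Ioc s t))
    (hgi : ∀ᵐ r ∂volume.restrict (Ioc s t), Integrable (g r) (ρ r : Measure (Param d)))
    (hgG : ∀ᵐ r ∂volume.restrict (Ioc s t), ∫ θ, g r θ ∂(ρ r : Measure (Param d)) ≤ G r)
    (hg : ∀ᵐ r ∂volume.restrict (Ioc s t), ∀ᵐ θ ∂(ρ r : Measure (Param d)),
      |fderiv ℝ h θ (α r θ, β r θ)| ≤ g r θ) :
    |(∫ θ, h θ ∂(ρ t : Measure (Param d))) - ∫ θ, h θ ∂(ρ s : Measure (Param d))| ≤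
      ∫ r in s..t, G r := by
  have hC0 : 0 ≤ C := (abs_nonneg _).trans (hC 0)
  let b : ContDiffBump (0 : Inp d) := ⟨1, 2, one_pos, one_lt_two⟩
  obtain ⟨D, hD⟩ := ((b.contDiff (n := 1)).continuous_fderiv one_ne_zero
    ).bounded_above_of_compact_support (b.hasCompactSupport.fderiv (𝕜 := ℝ))
  have hD0 : 0 ≤ D := (norm_nonneg _).trans (hD 0)
  set c : ℕ → ℝ := fun n => ((n : ℝ) + 1)⁻¹ with hcdef
  have hcpos : ∀ n, 0 < c n := fun n => by positivity
  have hclim : Tendsto c atTop (𝓝 0) := by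
    simpa [hcdef] using tendsto_one_div_add_atTop_nhds_zero_nat (𝕜 := ℝ)
  -- Cutoffs in `w` at scale `n + 1`: their derivative is at most `D * c n`, and where `h` lives the
  -- `w`-velocity is at most `|R| * B`. The extra term therefore tends to zero.
  set ζ : ℕ → Param d → ℝ := fun n θ => b (c n • θ.2) with hζ
  have hζs : ∀ n, ContDiff ℝ ∞ (ζ n) := fun n => b.contDiff.comp (contDiff_snd.const_smul (c n))
  have hζ1 : ∀ n θ, |ζ n θ| ≤ 1 := fun n θ => by
    rw [abs_of_nonneg b.nonneg]; exact b.le_one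
  have hζlim : ∀ θ, Tendsto (fun n => ζ n θ) atTop (𝓝 1) := fun θ => by
    have h1 : Tendsto (fun n => c n • θ.2) atTop (𝓝 0) := by
      simpa using hclim.smul_const θ.2
    have h2 := (b.continuous.tendsto 0).comp h1
    rwa [b.one_of_mem_closedBall (by simp [b.rIn_pos.le])] at h2
  have hζd : ∀ n θ x v, |fderiv ℝ (ζ n) θ (x, v)| ≤ D * (c n * ‖v‖) := by
    intro n θ x v
    have h1 : HasFDerivAt (ζ n) ((fderiv ℝ b (c n • θ.2)).comp
        (c n • ContinuousLinearMap.snd ℝ ℝ (Inp d))) θ :=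
      (b.contDiff.differentiable one_ne_zero _).hasFDerivAt.comp θ
        ((hasFDerivAt_snd (p := θ)).const_smul (c n))
    rw [h1.fderiv]
    refine ((fderiv ℝ b (c n • θ.2)).le_opNorm _).trans ?_
    refine mul_le_mul (hD _) ?_ (norm_nonneg _) hD0
    simp [norm_smul, abs_of_pos (hcpos n)]
  set hn : ℕ → Param d → ℝ := fun n θ => h θ * ζ n θ with hhn
  have hns : ∀ n, ContDiff ℝ ∞ (hn n) := fun n => hh.mul (hζs n)
  have hnc : ∀ n, HasCompactSupport (hn n) := fun n => by
    refine HasCompactSupport.of_support_subset_isCompact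
      (IsCompact.prod (isCompact_Icc (a := -R) (b := R))
        (isCompact_closedBall (0 : Inp d) (2 / c n))) fun θ hθ => ⟨?_, ?_⟩
    · by_contra hcon
      refine left_ne_zero_of_mul hθ (hR θ ?_)
      rw [mem_Icc, ← abs_le] at hcon
      exact not_le.1 hcon
    · have h1 : c n • θ.2 ∈ Function.support b := right_ne_zero_of_mul hθ
      rw [b.support_eq, mem_ball_zero_iff, norm_smul, Real.norm_of_nonneg (hcpos n).le] at h1
      rw [mem_closedBall_zero_iff, le_div_iff₀ (hcpos n), mul_comm]
      exact h1.le
  have hnlim : ∀ r, Tendsto (fun n => ∫ θ, hn n θ ∂(ρ r : Measure (Param d))) atTop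
      (𝓝 (∫ θ, h θ ∂(ρ r : Measure (Param d)))) := fun r => by
    refine tendsto_integral_of_dominated_convergence (fun _ => C)
      (fun n => (hns n).continuous.aestronglyMeasurable) (integrable_const _)
      (fun n => ae_of_all _ fun θ => ?_) (ae_of_all _ fun θ => ?_)
    · rw [hhn, Real.norm_eq_abs, abs_mul]
      nlinarith [hC θ, hζ1 n θ, abs_nonneg (h θ), abs_nonneg (ζ n θ)]
    · simpa using (hζlim θ).const_mul (h θ)
  have hBi : IntervalIntegrable B volume s t := by
    rw [intervalIntegrable_iff_integrableOn_Ioc_of_le hst]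
    exact (hρ.integrableOn_bound t).mono_set (Ioc_subset_Ioc_left hs)
  have hGi : IntervalIntegrable G volume s t :=
    (intervalIntegrable_iff_integrableOn_Ioc_of_le hst).2 hG
  have main : ∀ n, |(∫ θ, hn n θ ∂(ρ t : Measure (Param d))) -
      ∫ θ, hn n θ ∂(ρ s : Measure (Param d))| ≤
      (∫ r in s..t, G r) + c n * (C * D * |R| * ∫ r in s..t, B r) := fun n => by
    rw [hρ.integral_sub_integral (hns n) (hnc n) hs hst, abs_neg]
    have e : (∫ r in s..t, G r) + c n * (C * D * |R| * ∫ r in s..t, B r) =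
        ∫ r in s..t, (G r + c n * (C * D * |R| * B r)) := by
      rw [intervalIntegral.integral_add hGi ((hBi.const_mul _).const_mul _),
        intervalIntegral.integral_const_mul, intervalIntegral.integral_const_mul]
    rw [e, ← Real.norm_eq_abs]
    refine intervalIntegral.norm_integral_le_of_norm_le hst ?_
      (hGi.add ((hBi.const_mul _).const_mul _))
    rw [← ae_restrict_iff' measurableSet_Ioc]
    have hsub : Ioc s t ⊆ Ioi 0 := fun x hx => hs.trans_lt hx.1
    filter_upwards [hgi, hgG, hg, ae_restrict_of_ae_restrict_of_subset hsub hρ.norm_snd_le] with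
      r h1 h2 h3 h4
    refine (norm_integral_le_of_norm_le (h1.add (integrable_const (c n * (C * D * |R| * B r))))
      ?_).trans ?_
    · filter_upwards [h3] with θ hθ
      have hd1 : DifferentiableAt ℝ h θ := hh.differentiable (by simp) θ
      have hd2 : DifferentiableAt ℝ (ζ n) θ := (hζs n).differentiable (by simp) θ
      have e2 : fderiv ℝ (hn n) θ (α r θ, β r θ) =
          h θ * fderiv ℝ (ζ n) θ (α r θ, β r θ) + ζ n θ * fderiv ℝ h θ (α r θ, β r θ) := by
        rw [hhn]
        simp only
        rw [fderiv_fun_mul hd1 hd2]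
        simp
      rw [e2, Real.norm_eq_abs, Pi.add_apply, add_comm (g r θ)]
      refine (abs_add_le _ _).trans (add_le_add ?_ ?_)
      · by_cases hθR : R < |θ.1|
        · rw [hR θ hθR]
          have := hρ.bound_nonneg r
          have := (hcpos n).le
          simp only [zero_mul, abs_zero]
          positivity
        · rw [abs_mul]
          have hB := hρ.bound_nonneg r
          have h5 : ‖β r θ‖ ≤ |R| * B r := (h4 θ).trans
            (mul_le_mul_of_nonneg_right ((not_lt.1 hθR).trans (le_abs_self R)) hB)
          calc |h θ| * |fderiv ℝ (ζ n) θ (α r θ, β r θ)|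
              ≤ C * (D * (c n * (|R| * B r))) := by
                refine mul_le_mul (hC θ) ((hζd n θ _ _).trans ?_) (abs_nonneg _) hC0
                have := (hcpos n).le
                gcongr
            _ = _ := by ring
      · rw [abs_mul]
        calc |ζ n θ| * |fderiv ℝ h θ (α r θ, β r θ)| ≤ 1 * g r θ :=
              mul_le_mul (hζ1 n θ) hθ (abs_nonneg _) zero_le_one
          _ = g r θ := one_mul _
    · have : ∫ θ, (g r + fun _ : Param d => c n * (C * D * |R| * B r)) θ ∂(ρ r : Measure (Param d)) =
          (∫ θ, g r θ ∂(ρ r : Measure (Param d))) + c n * (C * D * |R| * B r) := by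
        rw [integral_add' h1 (integrable_const _)]
        simp
      rw [this]
      linarith
  have hlim2 : Tendsto (fun n => (∫ r in s..t, G r) + c n * (C * D * |R| * ∫ r in s..t, B r))
      atTop (𝓝 (∫ r in s..t, G r)) := by
    simpa using (hclim.mul_const (C * D * |R| * ∫ r in s..t, B r)).const_add (∫ r in s..t, G r)
  exact le_of_tendsto_of_tendsto' ((hnlim t).sub (hnlim s)).abs hlim2 main

end IsTransportedBy

/-! ### Almost sure boundedness of the output weights on bounded time intervals. -/

namespace IsTransportedBy

variable {d : ℕ} {ρ : ℝ → ProbabilityMeasure (Param d)} {α : ℝ → Param d → ℝ}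
  {β : ℝ → Param d → Inp d} {B : ℝ → ℝ}

open Filter Topology in
/-- The coordinate `a` stays bounded on bounded time intervals. -/
theorem exists_ae_abs_fst_le (hρ : IsTransportedBy ρ α β B) {K : ℝ}
    (h0 : ∀ᵐ θ ∂(ρ 0 : Measure (Param d)), |θ.1| ≤ K) {T : ℝ} (hT : 0 ≤ T) :
    ∃ R, 0 ≤ R ∧ ∀ t ∈ Icc 0 T, ∀ᵐ θ ∂(ρ t : Measure (Param d)), |θ.1| ≤ R := by
  let b : ContDiffBump (0 : ℝ) := ⟨1, 2, one_pos, one_lt_two⟩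
  obtain ⟨D, hD⟩ := ((b.contDiff (n := 1)).continuous_deriv le_rfl
    ).bounded_above_of_compact_support b.hasCompactSupport.deriv
  have hD0 : 0 ≤ D := (norm_nonneg _).trans (hD 0)
  have hBi : ∀ a c, 0 ≤ a → 0 ≤ c → IntervalIntegrable B volume a c := fun a c ha hc =>
    ⟨(hρ.integrableOn_bound c).mono_set (Ioc_subset_Ioc_left ha),
      (hρ.integrableOn_bound a).mono_set (Ioc_subset_Ioc_left hc)⟩
  set I := ∫ r in (0 : ℝ)..T, B r with hI
  have hI0 : 0 ≤ I := intervalIntegral.integral_nonneg hT fun r _ => hρ.bound_nonneg r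
  -- With this `q` the bump `u` has plateau `|a| ≤ q`, which contains `|a| ≤ K`. Its height `q / (D
  -- + 1)` is at least `2 * I + 1`, while its slope is at most `D / (D + 1)`.
  set q : ℝ := |K| + 1 + (D + 1) * (2 * I + 1) with hq
  have hqpos : 0 < q := by positivity
  set u : ℝ → ℝ := fun a => q / (D + 1) * b (q⁻¹ * a) with hu
  have hus : ContDiff ℝ ∞ u := contDiff_const.mul (b.contDiff.comp (contDiff_const.mul contDiff_id))
  have hu0 : ∀ a, 0 ≤ u a := fun a => mul_nonneg (by positivity) b.nonneg
  have hud : ∀ a, ∃ u', HasDerivAt u u' a ∧ |u'| ≤ 1 := fun a => by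
    have h1 : HasDerivAt (fun a : ℝ => q⁻¹ * a) q⁻¹ a := by
      simpa using (hasDerivAt_id a).const_mul q⁻¹
    have h2 := ((b.contDiff (n := 1)).differentiable one_ne_zero (q⁻¹ * a)).hasDerivAt.comp a h1
    refine ⟨_, h2.const_mul (q / (D + 1)), ?_⟩
    have h3 : |deriv b (q⁻¹ * a)| ≤ D := hD _
    have h4 : q / (D + 1) * (deriv b (q⁻¹ * a) * q⁻¹) = deriv b (q⁻¹ * a) / (D + 1) := by
      field_simp
    rw [h4, abs_div, abs_of_pos (by positivity : 0 < D + 1), div_le_one (by positivity)]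
    linarith
  have huK : ∀ a, |a| ≤ K → 2 * I + 1 ≤ u a := fun a ha => by
    have h1 : b (q⁻¹ * a) = 1 := by
      refine b.one_of_mem_closedBall ?_
      rw [mem_closedBall_zero_iff, norm_mul, norm_inv, Real.norm_of_nonneg hqpos.le,
        inv_mul_le_iff₀ hqpos]
      have : b.rIn = 1 := rfl
      have h5 : 0 ≤ (D + 1) * (2 * I + 1) := by positivity
      rw [this, Real.norm_eq_abs, mul_one]
      linarith [le_abs_self K]
    rw [hu]
    simp only [h1, mul_one]
    rw [le_div_iff₀ (by positivity)]
    linarith [abs_nonneg K]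
  have hufar : ∀ a, 2 * q < |a| → u a = 0 := fun a ha => by
    have : b (q⁻¹ * a) = 0 := by
      refine b.zero_of_le_dist ?_
      rw [dist_zero_right, norm_mul, norm_inv, Real.norm_of_nonneg hqpos.le,
        le_inv_mul_iff₀ hqpos, Real.norm_eq_abs]
      have h2 : b.rOut = 2 := rfl
      rw [h2]; linarith
    simp [hu, this]
  refine ⟨2 * q, by positivity, fun t ht => ?_⟩
  -- The integral starts below `exp (-n (2I + 1))` and grows by at most `exp (2nI + 1)`. The
  -- integrand equals 1 for `|a| > 2q`, so the same bound controls the mass there.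
  have key : ∀ n : ℕ, ∫ θ, Real.exp (-(n * u θ.1)) ∂(ρ t : Measure (Param d)) ≤
      Real.exp (1 - n) := fun n => by
    set e : Param d → ℝ := fun θ => Real.exp (-(n * u θ.1)) with he
    have hes : ContDiff ℝ ∞ e :=
      Real.contDiff_exp.comp (contDiff_const.mul (hus.comp contDiff_fst)).neg
    have he0 : ∀ θ, 0 ≤ e θ := fun θ => (Real.exp_pos _).le
    have he1 : ∀ θ, |e θ| ≤ 1 := fun θ => by
      rw [abs_of_nonneg (he0 θ), he, Real.exp_le_one_iff]
      have := hu0 θ.1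
      simp only [Left.neg_nonpos_iff]; positivity
    have hei : ∀ r, Integrable e (ρ r : Measure (Param d)) := fun r =>
      Integrable.of_bound hes.continuous.aestronglyMeasurable 1 (ae_of_all _ he1)
    set F : ℝ → ℝ := fun r => ∫ θ, e θ ∂(ρ r : Measure (Param d)) with hF
    have hFc : Continuous F := hρ.continuous_integral hes.continuous he1
    have hstep : ∀ r s, 0 ≤ r → r ≤ s → s ≤ T → |F s - F r| ≤ ∫ x in r..s, (n * B x) * F x := by
      intro r s hr hrs _
      have hint : ∀ x, ∫ θ, (1 - e θ) ∂(ρ x : Measure (Param d)) = 1 - F x := fun x => by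
        rw [integral_sub (integrable_const _) (hei x)]; simp [hF]
      -- Test with `1 - e` rather than `e`: it is the former that vanishes for large `|a|`.
      have h1 := hρ.abs_integral_sub_integral_le (h := fun θ => 1 - e θ) (contDiff_const.sub hes)
        (C := 1) (R := 2 * q)
        (fun θ => by rw [abs_of_nonneg] <;> linarith [(abs_le.1 (he1 θ)).2, he0 θ])
        (fun θ hθ => by simp [he, hufar _ hθ]) hr hrs (g := fun x θ => n * B x * e θ)
        (G := fun x => n * B x * F x) ?_ (ae_of_all _ fun x => (hei x).const_mul _)
        (ae_of_all _ fun x => by rw [integral_const_mul]) ?_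
      · rw [hint, hint] at h1
        rwa [show 1 - F s - (1 - F r) = -(F s - F r) by ring, abs_neg] at h1
      · rw [← intervalIntegrable_iff_integrableOn_Ioc_of_le hrs]
        exact ((hBi r s hr (hr.trans hrs)).const_mul _).mul_continuousOn hFc.continuousOn
      · have hsub : Ioc r s ⊆ Ioi 0 := fun x hx => hr.trans_lt hx.1
        filter_upwards [ae_restrict_of_ae_restrict_of_subset hsub hρ.abs_fst_le] with x hx
        refine ae_of_all _ fun θ => ?_
        obtain ⟨u', hu', hu1⟩ := hud θ.1
        have h2 : HasFDerivAt (fun θ : Param d => 1 - e θ)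
            (-(Real.exp (-(n * u θ.1)) • -((n : ℝ) • (u' • ContinuousLinearMap.fst ℝ ℝ (Inp d)))))
            θ :=
          (((hu'.comp_hasFDerivAt θ hasFDerivAt_fst).const_mul (n : ℝ)).neg.exp).const_sub 1
        rw [h2.fderiv]
        have h3 : (-(Real.exp (-(n * u θ.1)) • -((n : ℝ) •
            (u' • ContinuousLinearMap.fst ℝ ℝ (Inp d))))) (α x θ, β x θ) =
            n * e θ * (u' * α x θ) := by
          simp [he]; ring
        rw [h3, abs_mul, abs_mul, abs_mul, Nat.abs_cast, abs_of_nonneg (he0 θ)]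
        have h4 : |u'| * |α x θ| ≤ 1 * B x := mul_le_mul hu1 (hx θ) (abs_nonneg _) zero_le_one
        have h5 : 0 ≤ n * e θ := mul_nonneg (by positivity) (he0 θ)
        nlinarith
    have hN := le_two_pow_mul_of_abs_sub_le_integral hFc (fun r => integral_nonneg he0)
      (c := fun x => n * B x)
      (fun x => mul_nonneg (by positivity) (hρ.bound_nonneg x))
      (fun T => (hρ.integrableOn_bound T).const_mul _) hstep ⌈2 * (n * I)⌉₊ 0 t le_rfl ht.1 ht.2 ?_
    · have hF0 : F 0 ≤ Real.exp (-(n * (2 * I + 1))) := by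
        have : F 0 ≤ ∫ θ, Real.exp (-(n * (2 * I + 1))) ∂(ρ 0 : Measure (Param d)) := by
          refine integral_mono_ae (hei 0) (integrable_const _) ?_
          filter_upwards [h0] with θ hθ
          rw [he]
          simp only [Real.exp_le_exp, neg_le_neg_iff]
          exact mul_le_mul_of_nonneg_left (huK _ hθ) (by positivity)
        simpa using this
      have hpow : (2 : ℝ) ^ ⌈2 * (n * I)⌉₊ ≤ Real.exp (2 * (n * I) + 1) := by
        calc (2 : ℝ) ^ ⌈2 * (n * I)⌉₊ ≤ Real.exp 1 ^ ⌈2 * (n * I)⌉₊ := by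
              gcongr
              linarith [Real.add_one_le_exp 1]
          _ = Real.exp ⌈2 * (n * I)⌉₊ := by rw [← Real.exp_nat_mul, mul_one]
          _ ≤ Real.exp (2 * (n * I) + 1) := by
              gcongr
              exact (Nat.ceil_lt_add_one (by positivity)).le
      calc F t ≤ 2 ^ ⌈2 * (n * I)⌉₊ * F 0 := hN
        _ ≤ Real.exp (2 * (n * I) + 1) * Real.exp (-(n * (2 * I + 1))) :=
            mul_le_mul hpow hF0 (integral_nonneg he0) (Real.exp_pos _).le
        _ = Real.exp (1 - n) := by rw [← Real.exp_add]; congr 1; ring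
    · rw [intervalIntegral.integral_const_mul]
      have h1 : ∫ r in (0 : ℝ)..t, B r ≤ I := by
        rw [hI, ← intervalIntegral.integral_add_adjacent_intervals (hBi 0 t le_rfl ht.1)
          (hBi t T ht.1 hT)]
        linarith [intervalIntegral.integral_nonneg (μ := volume) ht.2
          fun r _ => hρ.bound_nonneg r]
      have h2 := Nat.le_ceil (2 * (n * I))
      have h3 : n * ∫ r in (0 : ℝ)..t, B r ≤ n * I := mul_le_mul_of_nonneg_left h1 (by positivity)
      linarith
  have hmS : MeasurableSet {θ : Param d | 2 * q < |θ.1|} :=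
    measurableSet_lt measurable_const measurable_fst.abs
  have hle : ∀ n : ℕ, (ρ t : Measure (Param d)).real {θ | 2 * q < |θ.1|} ≤ Real.exp (1 - n) :=
    fun n => by
      refine le_trans ?_ (key n)
      rw [← integral_indicator_one hmS]
      refine integral_mono_of_nonneg (ae_of_all _ fun θ => indicator_nonneg (by simp) θ)
        (Integrable.of_bound (by
          have := hus.continuous
          exact Continuous.aestronglyMeasurable (by fun_prop)) 1 (ae_of_all _ fun θ => ?_))
        (ae_of_all _ fun θ => ?_)
      · rw [Real.norm_of_nonneg (Real.exp_pos _).le, Real.exp_le_one_iff]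
        have := hu0 θ.1
        simp only [Left.neg_nonpos_iff]; positivity
      · by_cases hθ : 2 * q < |θ.1|
        · simp [hufar _ hθ, hθ]
        · simp [hθ, Real.exp_nonneg]
  have hlim : Tendsto (fun n : ℕ => Real.exp (1 - n)) atTop (𝓝 0) := by
    refine Real.tendsto_exp_atBot.comp ?_
    exact tendsto_atBot_add_const_left _ 1
      (tendsto_neg_atTop_atBot.comp tendsto_natCast_atTop_atTop)
  have hzero : (ρ t : Measure (Param d)).real {θ | 2 * q < |θ.1|} = 0 :=
    le_antisymm (ge_of_tendsto' hlim hle) measureReal_nonneg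
  rw [measureReal_eq_zero_iff] at hzero
  rw [ae_iff]
  simpa using hzero

end IsTransportedBy

/-! ### A bounded observable measuring the component along $S$. -/

theorem sq_integral_le_integral_sq {Ω : Type*} [MeasurableSpace Ω] {μ : Measure Ω}
    [IsProbabilityMeasure μ] {f : Ω → ℝ} (hf : Integrable f μ)
    (hf2 : Integrable (fun x => f x ^ 2) μ) : (∫ x, f x ∂μ) ^ 2 ≤ ∫ x, f x ^ 2 ∂μ := by
  set m := ∫ x, f x ∂μ with hm
  have h1 : 0 ≤ ∫ x, (f x - m) ^ 2 ∂μ := integral_nonneg fun x => sq_nonneg _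
  have h2 : ∫ x, (f x - m) ^ 2 ∂μ = (∫ x, f x ^ 2 ∂μ) - m ^ 2 := by
    have : ∀ x, (f x - m) ^ 2 = f x ^ 2 - (2 * m * f x - m ^ 2) := fun x => by ring
    simp only [this]
    have i1 : Integrable (fun x => 2 * m * f x) μ := hf.const_mul _
    have i2 : Integrable (fun x => 2 * m * f x - m ^ 2) μ := i1.sub (integrable_const _)
    rw [integral_sub hf2 i2,
      integral_sub i1 (integrable_const _), integral_const_mul, ← hm]
    simp
    ring
  linarith

/-- With $y=p^2/(1+p^2)$, the left side has the form of the derivative of the saturated square along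
the flow. Young's inequality splits $pm$, and the denominator converts $p^2$ into $y$, so the
Grönwall inequality closes without moments of $p$. -/
theorem inv_sq_mul_le {p m y c X : ℝ} (hc : 0 ≤ c)
    (hy : y * (1 + p ^ 2) = p ^ 2) (hX : X ≤ c * (p ^ 2 + p * m)) :
    ((1 + p ^ 2) ^ 2)⁻¹ * (2 * X) ≤ 2 * c * (2 * y + m ^ 2) := by
  rw [inv_mul_le_iff₀ (by positivity)]
  have h7 : p ^ 2 + p * m ≤ (1 + p ^ 2) ^ 2 * (2 * y + m ^ 2) := by
    have e1 : (1 + p ^ 2) ^ 2 * (2 * y) = (1 + p ^ 2) * (2 * p ^ 2) := by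
      linear_combination (2 * (1 + p ^ 2)) * hy
    rw [mul_add, e1]
    nlinarith [sq_nonneg (p - m), sq_nonneg (p * m), sq_nonneg (p ^ 2 * m),
      sq_nonneg (p ^ 2), sq_nonneg p, sq_nonneg m]
  calc 2 * X ≤ 2 * c * (p ^ 2 + p * m) := by linarith
    _ ≤ 2 * c * ((1 + p ^ 2) ^ 2 * (2 * y + m ^ 2)) := by gcongr
    _ = _ := by ring

/-- The map `(a, w) ↦ w_S` as a continuous linear map. -/
noncomputable def projSL {d : ℕ} (S : Submodule ℝ (Inp d)) : Param d →L[ℝ] S :=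
  S.orthogonalProjectionOnto.comp (ContinuousLinearMap.snd ℝ ℝ (Inp d))

theorem continuous_projS {d : ℕ} (S : Submodule ℝ (Inp d)) : Continuous (projS S) :=
  (projSL S).continuous

/-- The saturated square `‖w_S‖² / (1 + ‖w_S‖²)`. -/
noncomputable def satProjS {d : ℕ} (S : Submodule ℝ (Inp d)) (θ : Param d) : ℝ :=
  1 - (1 + ‖projS S θ‖ ^ 2)⁻¹

section satProjS

variable {d : ℕ} (S : Submodule ℝ (Inp d))

theorem contDiff_satProjS : ContDiff ℝ ∞ (satProjS S) := by
  refine contDiff_const.sub (ContDiff.inv ?_ fun θ => ?_)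
  · exact contDiff_const.add ((projSL S).contDiff.norm_sq ℝ)
  · have : 0 < 1 + ‖projS S θ‖ ^ 2 := by positivity
    exact this.ne'

theorem satProjS_nonneg (θ : Param d) : 0 ≤ satProjS S θ := by
  rw [satProjS, sub_nonneg]
  exact inv_le_one_of_one_le₀ (by nlinarith [sq_nonneg ‖projS S θ‖])

theorem abs_satProjS_le_one (θ : Param d) : |satProjS S θ| ≤ 1 := by
  rw [abs_of_nonneg (satProjS_nonneg S θ), satProjS]
  have : 0 < (1 + ‖projS S θ‖ ^ 2)⁻¹ := by positivity
  linarith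

theorem satProjS_mul_eq (θ : Param d) :
    satProjS S θ * (1 + ‖projS S θ‖ ^ 2) = ‖projS S θ‖ ^ 2 := by
  have : 0 < 1 + ‖projS S θ‖ ^ 2 := by positivity
  rw [satProjS]
  field_simp
  ring

theorem fderiv_satProjS_apply (θ : Param d) (x : ℝ) (v : Inp d) :
    fderiv ℝ (satProjS S) θ (x, v) =
      ((1 + ‖projS S θ‖ ^ 2) ^ 2)⁻¹ * (2 * inner ℝ (projS S θ : Inp d) v) := by
  have hpos : 0 < 1 + ‖projS S θ‖ ^ 2 := by positivity
  have h1 : HasFDerivAt (fun θ => ‖projSL S θ‖ ^ 2) _ θ := (projSL S).hasFDerivAt.norm_sq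
  have h2 : HasFDerivAt (satProjS S) _ θ :=
    (((hasDerivAt_inv hpos.ne').comp_hasFDerivAt θ (h1.const_add 1))).const_sub 1
  rw [h2.fderiv]
  simp [projSL, projS]

theorem integrable_satProjS (μ : Measure (Param d)) [IsFiniteMeasure μ] :
    Integrable (satProjS S) μ :=
  Integrable.of_bound (contDiff_satProjS S).continuous.aestronglyMeasurable 1
    (ae_of_all _ (abs_satProjS_le_one S))

theorem abs_min_one_norm_projS_le (θ : Param d) : |min 1 ‖projS S θ‖| ≤ 1 := by
  rw [abs_of_nonneg (le_min zero_le_one (norm_nonneg _))]; exact min_le_left _ _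

theorem integrable_min_one_norm_projS (μ : Measure (Param d)) [IsFiniteMeasure μ] :
    Integrable (fun θ => min 1 ‖projS S θ‖) μ :=
  Integrable.of_bound (continuous_const.min (continuous_projS S).norm).aestronglyMeasurable 1
    (ae_of_all _ (abs_min_one_norm_projS_le S))

/-- Jensen's inequality and the pointwise bound $\min(1,p)^2\le 2p^2/(1+p^2)$, checked separately
for $p\ge1$ and $p\le1$. It returns the mean-field term to the Grönwall quantity. -/
theorem sq_integral_min_one_norm_projS_le (μ : Measure (Param d)) [IsProbabilityMeasure μ] :
    (∫ θ, min 1 ‖projS S θ‖ ∂μ) ^ 2 ≤ 2 * ∫ θ, satProjS S θ ∂μ := by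
  have i2 : Integrable (fun θ => min 1 ‖projS S θ‖ ^ 2) μ :=
    Integrable.of_bound ((continuous_const.min (continuous_projS S).norm).pow 2
      ).aestronglyMeasurable 1 (ae_of_all _ fun θ => by
        rw [norm_pow]; exact pow_le_one₀ (norm_nonneg _) (abs_min_one_norm_projS_le S θ))
  refine (sq_integral_le_integral_sq (integrable_min_one_norm_projS S μ) i2).trans ?_
  rw [← integral_const_mul]
  refine integral_mono i2 ((integrable_satProjS S μ).const_mul 2) fun θ => ?_
  have h1 := satProjS_mul_eq S θ
  have h2 := satProjS_nonneg S θ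
  have h3 := norm_nonneg (projS S θ)
  simp only
  rcases le_total 1 ‖projS S θ‖ with h | h
  · rw [min_eq_left h]; nlinarith
  · rw [min_eq_right h]
    have h4 : ‖projS S θ‖ ^ 2 ≤ 1 := pow_le_one₀ h3 h
    nlinarith

end satProjS

/-! ### Propagation of $w_S=0$. -/

namespace IsTransportedBy

variable {d : ℕ} {ρ : ℝ → ProbabilityMeasure (Param d)} {α : ℝ → Param d → ℝ}
  {β : ℝ → Param d → Inp d} {B : ℝ → ℝ}

/-- If the velocity of `w_S` is controlled by `w_S` itself and by its mean size, then `w_S = 0`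
propagates in time. -/
theorem ae_projS_eq_zero (hρ : IsTransportedBy ρ α β B) {K : ℝ}
    (h0 : ∀ᵐ θ ∂(ρ 0 : Measure (Param d)), |θ.1| ≤ K) (S : Submodule ℝ (Inp d))
    (h0S : ∀ᵐ θ ∂(ρ 0 : Measure (Param d)), projS S θ = 0)
    (hβ : ∀ R, 0 ≤ R → ∃ C, 0 ≤ C ∧ ∀ᵐ r ∂volume.restrict (Ioi (0 : ℝ)),
      (∀ᵐ θ ∂(ρ r : Measure (Param d)), |θ.1| ≤ R) → ∀ θ,
        |inner ℝ (projS S θ : Inp d) (β r θ)| ≤ |θ.1| * (C * (‖projS S θ‖ ^ 2 +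
          ‖projS S θ‖ * ∫ θ', min 1 ‖projS S θ'‖ ∂(ρ r : Measure (Param d)))))
    {T : ℝ} (hT : 0 ≤ T) :
    ∀ᵐ θ ∂(ρ T : Measure (Param d)), projS S θ = 0 := by
  obtain ⟨R, hR0, hR⟩ := hρ.exists_ae_abs_fst_le h0 hT
  obtain ⟨C, hC0, hC⟩ := hβ R hR0
  set ψ : Param d → ℝ := satProjS S with hψ
  have hψs : ContDiff ℝ ∞ ψ := contDiff_satProjS S
  have hψ0 : ∀ θ, 0 ≤ ψ θ := satProjS_nonneg S
  have hψ1 : ∀ θ, |ψ θ| ≤ 1 := abs_satProjS_le_one S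
  have hψi : ∀ r, Integrable ψ (ρ r : Measure (Param d)) := fun r =>
    Integrable.of_bound hψs.continuous.aestronglyMeasurable 1 (ae_of_all _ hψ1)
  set F : ℝ → ℝ := fun r => ∫ θ, ψ θ ∂(ρ r : Measure (Param d)) with hF
  have hFc : Continuous F := hρ.continuous_integral hψs.continuous hψ1
  have hF0 : ∀ r, 0 ≤ F r := fun r => integral_nonneg hψ0
  set m : ℝ → ℝ := fun r => ∫ θ, min 1 ‖projS S θ‖ ∂(ρ r : Measure (Param d)) with hm
  have hmF : ∀ r, m r ^ 2 ≤ 2 * F r := fun r =>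
    sq_integral_min_one_norm_projS_le S _
  -- Admissible test functions have bounded support in `a`. The plateau radius exceeds `R`, so
  -- almost surely the cutoff changes neither `ψ` nor its derivative.
  let b : ContDiffBump (0 : ℝ) := ⟨R + 1, R + 2, by linarith, by linarith⟩
  set h : Param d → ℝ := fun θ => b θ.1 * ψ θ with hh
  have hbs : ContDiff ℝ ∞ b := b.contDiff
  have hs : ContDiff ℝ ∞ h := (hbs.comp contDiff_fst).mul hψs
  have hb1 : ∀ a : ℝ, |a| ≤ R → b a = 1 := fun a ha =>
    b.one_of_mem_closedBall (by
      rw [mem_closedBall_zero_iff, Real.norm_eq_abs]; exact ha.trans (by simp [b]))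
  have hint : ∀ r ∈ Icc 0 T, ∫ θ, h θ ∂(ρ r : Measure (Param d)) = F r := fun r hr => by
    refine integral_congr_ae ?_
    filter_upwards [hR r hr] with θ hθ
    simp [hh, hb1 _ hθ]
  have hstep : ∀ r s, 0 ≤ r → r ≤ s → s ≤ T →
      |F s - F r| ≤ ∫ x in r..s, (8 * R * C) * F x := by
    intro r s hr hrs hsT
    have hsub : Ioc r s ⊆ Ioi 0 := fun x hx => hr.trans_lt hx.1
    have h1 := hρ.abs_integral_sub_integral_le hs (C := 1) (R := R + 2) (fun θ => ?_)
      (fun θ hθ => ?_) hr hrs (g := fun x θ => 2 * (R * C) * (2 * ψ θ + m x ^ 2))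
      (G := fun x => (8 * R * C) * F x)
      (((hFc.const_mul (8 * R * C)).integrableOn_Icc (a := r) (b := s)).mono_set
        Ioc_subset_Icc_self)
      (ae_of_all _ fun x => (((hψi x).const_mul _).add (integrable_const _)).const_mul _)
      (ae_of_all _ fun x => ?_) ?_
    · rwa [hint s ⟨hr.trans hrs, hsT⟩, hint r ⟨hr, hrs.trans hsT⟩] at h1
    · rw [hh, abs_mul, abs_of_nonneg b.nonneg]
      exact mul_le_one₀ b.le_one (abs_nonneg _) (hψ1 θ)
    · have : b θ.1 = 0 := b.zero_of_le_dist (by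
        rw [dist_zero_right, Real.norm_eq_abs]; exact hθ.le)
      simp [hh, this]
    · rw [integral_const_mul, integral_add ((hψi x).const_mul _) (integrable_const _),
        integral_const_mul]
      have h2 := hmF x
      have h3 : 0 ≤ 2 * (R * C) := by positivity
      simp only [integral_const, probReal_univ, one_smul]
      -- Here `m x ^ 2 ≤ 2 * F x` closes the estimate, whence the rate `8 * R * C`.
      calc 2 * (R * C) * (2 * F x + m x ^ 2) ≤ 2 * (R * C) * (2 * F x + 2 * F x) := by gcongr
        _ = _ := by ring
    · filter_upwards [ae_restrict_of_ae_restrict_of_subset hsub hC,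
        ae_restrict_mem measurableSet_Ioc] with x hx hxm
      have hRx := hR x ⟨hr.trans hxm.1.le, hxm.2.trans hsT⟩
      filter_upwards [hRx] with θ hθ
      have hb : ∀ᶠ a in nhds θ.1, b a = 1 := by
        refine b.eventuallyEq_one_of_mem_ball ?_
        rw [mem_ball_zero_iff, Real.norm_eq_abs]
        exact hθ.trans_lt (by simp [b])
      have hhd : fderiv ℝ h θ = fderiv ℝ ψ θ := by
        refine Filter.EventuallyEq.fderiv_eq ?_
        filter_upwards [continuous_fst.continuousAt.eventually hb] with θ' hθ'
        simp [hh, hθ']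
      rw [hhd, hψ, fderiv_satProjS_apply, abs_mul, abs_mul, abs_two,
        abs_of_nonneg (by positivity : 0 ≤ ((1 + ‖projS S θ‖ ^ 2) ^ 2)⁻¹)]
      have hm0 : 0 ≤ m x := integral_nonneg fun θ => le_min zero_le_one (norm_nonneg _)
      have h6 : |inner ℝ (projS S θ : Inp d) (β x θ)| ≤
          R * C * (‖projS S θ‖ ^ 2 + ‖projS S θ‖ * m x) := by
        rw [mul_assoc]
        exact (hx hRx θ).trans (mul_le_mul_of_nonneg_right hθ (by positivity))
      exact inv_sq_mul_le (mul_nonneg hR0 hC0) (satProjS_mul_eq S θ) h6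
  have hN := le_two_pow_mul_of_abs_sub_le_integral hFc hF0 (c := fun _ => 8 * R * C)
    (fun _ => by positivity) (fun _ => (integrable_const _)) hstep
    ⌈2 * (T * (8 * R * C))⌉₊ 0 T le_rfl hT le_rfl (by
      have := Nat.le_ceil (2 * (T * (8 * R * C)))
      simp only [intervalIntegral.integral_const, sub_zero, smul_eq_mul]
      linarith)
  have hF00 : F 0 = 0 := integral_eq_zero_of_ae (by
    filter_upwards [h0S] with θ hθ
    simp [hψ, satProjS, hθ])
  rw [hF00, mul_zero] at hN
  have hFT : ∫ θ, ψ θ ∂(ρ T : Measure (Param d)) = 0 := le_antisymm hN (hF0 T)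
  rw [integral_eq_zero_iff_of_nonneg hψ0 (hψi T)] at hFT
  filter_upwards [hFT] with θ hθ
  have h1 := satProjS_mul_eq S θ
  rw [show satProjS S θ = 0 from hθ] at h1
  have h2 : ‖projS S θ‖ ^ 2 = 0 := by simpa using h1.symm
  simpa using h2

end IsTransportedBy

/-! ### Gaussian integrability and the gradient of the potential. -/

theorem MvPolynomial.exists_abs_eval_le {ι : Type*} [Fintype ι] (p : MvPolynomial ι ℝ) :
    ∃ (C : ℝ) (N : ℕ), 0 ≤ C ∧ ∀ x : EuclideanSpace ℝ ι,
      |MvPolynomial.eval (fun i => x i) p| ≤ C * (1 + ‖x‖) ^ N := by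
  induction p using MvPolynomial.induction_on with
  | C a => exact ⟨|a|, 0, abs_nonneg a, fun x => by simp⟩
  | add p q hp hq =>
    obtain ⟨C, N, hC, h⟩ := hp
    obtain ⟨C', N', hC', h'⟩ := hq
    refine ⟨C + C', max N N', by positivity, fun x => ?_⟩
    have h1 : (1 : ℝ) ≤ 1 + ‖x‖ := by linarith [norm_nonneg x]
    rw [map_add, add_mul]
    refine (abs_add_le _ _).trans (add_le_add ((h x).trans ?_) ((h' x).trans ?_))
    · exact mul_le_mul_of_nonneg_left (pow_le_pow_right₀ h1 (le_max_left _ _)) hC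
    · exact mul_le_mul_of_nonneg_left (pow_le_pow_right₀ h1 (le_max_right _ _)) hC'
  | mul_X p i hp =>
    obtain ⟨C, N, hC, h⟩ := hp
    refine ⟨C, N + 1, hC, fun x => ?_⟩
    have h1 : |x i| ≤ 1 + ‖x‖ := by
      have h2 : |x i| ≤ ‖x‖ := PiLp.norm_apply_le x i
      linarith
    rw [map_mul, MvPolynomial.eval_X, abs_mul, pow_succ, ← mul_assoc]
    exact mul_le_mul (h x) h1 (abs_nonneg _) (by positivity)

theorem integrable_one_add_norm_pow {E : Type*} [NormedAddCommGroup E] [InnerProductSpace ℝ E]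
    [FiniteDimensional ℝ E] [MeasurableSpace E] [BorelSpace E] (n : ℕ) :
    Integrable (fun x : E => (1 + ‖x‖) ^ n) (stdGaussian E) := by
  have h1 : MemLp (fun x : E => 1 + ‖x‖) n (stdGaussian E) :=
    (memLp_const (1 : ℝ)).add (IsGaussian.memLp_id (stdGaussian E) n (by simp)).norm
  refine h1.integrable_norm_pow'.congr (ae_of_all _ fun x => ?_)
  simp only [Real.norm_eq_abs]
  rw [abs_of_nonneg (by positivity)]

section

variable {d : ℕ}

theorem IsSubspaceSparsePolynomial.continuous {V : Submodule ℝ (Inp d)} {f : Inp d → ℝ}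
    (hf : IsSubspaceSparsePolynomial V f) : Continuous f := by
  obtain ⟨h, ⟨p, hp⟩, hfh⟩ := hf
  have : f = fun x => MvPolynomial.eval
      (fun i => (V.orthogonalProjectionOnto x : Inp d) i) p := by
    ext x; rw [hfh, hp]
  rw [this]
  refine (MvPolynomial.continuous_eval p).comp (continuous_pi fun i => ?_)
  fun_prop

/-- Polynomial growth against Gaussian moments. Besides continuity, this is all that is used of the
polynomial form of the target; it supplies the dominating functions below. -/
theorem IsSubspaceSparsePolynomial.integrable {V : Submodule ℝ (Inp d)} {f : Inp d → ℝ}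
    (hf : IsSubspaceSparsePolynomial V f) (n : ℕ) :
    Integrable (fun x => (1 + |f x|) * (1 + ‖x‖) ^ n) (stdGaussian (Inp d)) := by
  have hfc := hf.continuous
  obtain ⟨h, ⟨p, hp⟩, hfh⟩ := hf
  obtain ⟨C, N, hC, hb⟩ := p.exists_abs_eval_le
  refine Integrable.mono' ((integrable_one_add_norm_pow (N + n)).const_mul (1 + C))
    (Continuous.aestronglyMeasurable (by fun_prop)) (ae_of_all _ fun x => ?_)
  have h0 : (1 : ℝ) ≤ (1 + ‖x‖) ^ N := one_le_pow₀ (by linarith [norm_nonneg x])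
  have h1 : |f x| ≤ C * (1 + ‖x‖) ^ N := by
    rw [hfh, hp]
    refine (hb _).trans ?_
    gcongr
    exact V.norm_orthogonalProjectionOnto_apply_le x
  rw [Real.norm_of_nonneg (by positivity), pow_add, ← mul_assoc]
  gcongr
  linarith

/-- `𝔼_x[(f_NN(x; μ) - f(x)) σ(wᵀx)]`. -/
noncomputable def meanResidual (σ : ℝ → ℝ) (f : Inp d → ℝ) (μ : Measure (Param d))
    (w : Inp d) : ℝ :=
  ∫ x, (fNN σ μ x - f x) * σ (inner ℝ w x) ∂(stdGaussian (Inp d))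

/-- `𝔼_x[(f_NN(x; μ) - f(x)) σ'(wᵀx) x]`. -/
noncomputable def meanResidualGrad (σ : ℝ → ℝ) (f : Inp d → ℝ) (μ : Measure (Param d))
    (w : Inp d) : Inp d :=
  ∫ x, ((fNN σ μ x - f x) * deriv σ (inner ℝ w x)) • x ∂(stdGaussian (Inp d))

theorem derivA_Phi (σ : ℝ → ℝ) (f : Inp d → ℝ) (μ : Measure (Param d)) (θ : Param d) :
    derivA (Phi σ f μ) θ = meanResidual σ f μ θ.2 := by
  have : HasDerivAt (fun a : ℝ => a * meanResidual σ f μ θ.2) (1 * meanResidual σ f μ θ.2) θ.1 :=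
    (hasDerivAt_id θ.1).mul_const _
  rw [one_mul] at this
  exact this.deriv

namespace ActivationAssumption

variable {σ : ℝ → ℝ} {K : ℝ} (hσ : ActivationAssumption σ K)
include hσ

theorem nonneg : 0 ≤ K := (abs_nonneg _).trans (hσ.bound 0)

theorem differentiable : Differentiable ℝ σ := hσ.contDiff.differentiable two_ne_zero

theorem continuous_deriv : Continuous (deriv σ) := hσ.contDiff.continuous_deriv (by norm_num)

theorem differentiable_deriv : Differentiable ℝ (deriv σ) := by
  have : ContDiff ℝ (1 + 1) σ := by simpa [one_add_one_eq_two] using hσ.contDiff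
  exact ((contDiff_succ_iff_deriv.1 this).2.2).differentiable one_ne_zero

theorem abs_sub_le (u v : ℝ) : |σ u - σ v| ≤ K * |u - v| :=
  Convex.norm_image_sub_le_of_norm_deriv_le (fun x _ => hσ.differentiable x)
    (fun x _ => hσ.bound_deriv x) convex_univ (mem_univ v) (mem_univ u)

theorem abs_deriv_sub_le (u v : ℝ) : |deriv σ u - deriv σ v| ≤ K * |u - v| :=
  Convex.norm_image_sub_le_of_norm_deriv_le (fun x _ => hσ.differentiable_deriv x)
    (fun x _ => hσ.bound_deriv2 x) convex_univ (mem_univ v) (mem_univ u)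

theorem integrable_neuron {μ : Measure (Param d)} (hμ : Integrable (fun θ => θ.1) μ) (x : Inp d) :
    Integrable (fun θ : Param d => θ.1 * σ (inner ℝ θ.2 x)) μ := by
  have hc := hσ.contDiff.continuous
  refine Integrable.mono' (hμ.abs.const_mul K)
    (Continuous.aestronglyMeasurable (by fun_prop)) (ae_of_all _ fun θ => ?_)
  rw [norm_mul, mul_comm K]
  exact mul_le_mul_of_nonneg_left (hσ.bound _) (abs_nonneg _)

theorem abs_fNN_le {μ : Measure (Param d)} (hμ : Integrable (fun θ => θ.1) μ) (x : Inp d) :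
    |fNN σ μ x| ≤ K * ∫ θ, |θ.1| ∂μ := by
  rw [← integral_const_mul, ← Real.norm_eq_abs]
  refine norm_integral_le_of_norm_le (hμ.abs.const_mul K) (ae_of_all _ fun θ => ?_)
  rw [norm_mul, mul_comm K]
  exact mul_le_mul_of_nonneg_left (hσ.bound _) (abs_nonneg _)

theorem stronglyMeasurable_fNN (μ : Measure (Param d)) [SFinite μ] :
    StronglyMeasurable (fNN σ μ) := by
  have hc := hσ.contDiff.continuous
  refine StronglyMeasurable.integral_prod_right
    (f := fun (x : Inp d) (θ : Param d) => θ.1 * σ (inner ℝ θ.2 x)) ?_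
  exact Continuous.stronglyMeasurable (by fun_prop)

/-- The product form separates the moment of `a`, which varies in time, from the dependence on `x`;
time integrability of that moment then suffices. -/
theorem abs_fNN_sub_le {μ : Measure (Param d)} (hμ : Integrable (fun θ => θ.1) μ)
    (f : Inp d → ℝ) (x : Inp d) :
    |fNN σ μ x - f x| ≤ (1 + K) * (1 + ∫ θ, |θ.1| ∂μ) * (1 + |f x|) := by
  have h1 := hσ.abs_fNN_le hμ x
  have h2 : 0 ≤ ∫ θ, |θ.1| ∂μ := integral_nonneg fun θ => abs_nonneg _
  have h3 := hσ.nonneg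
  have h4 := abs_nonneg (f x)
  have h5 := abs_sub (fNN σ μ x) (f x)
  set M := ∫ θ, |θ.1| ∂μ
  have h6 : 0 ≤ K * M := by positivity
  have h7 : 0 ≤ K * M * |f x| := by positivity
  have h8 : 0 ≤ K * |f x| := by positivity
  have h9 : 0 ≤ M * |f x| := by positivity
  calc |fNN σ μ x - f x| ≤ K * M + |f x| := h5.trans (by linarith)
    _ ≤ _ := by nlinarith

theorem abs_meanResidual_le {V : Submodule ℝ (Inp d)} {f : Inp d → ℝ}
    (hf : IsSubspaceSparsePolynomial V f)
    {μ : Measure (Param d)} (hμ : Integrable (fun θ => θ.1) μ) (w : Inp d) :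
    |meanResidual σ f μ w| ≤ (1 + K) * K * (1 + ∫ θ, |θ.1| ∂μ) *
      ∫ x, (1 + |f x|) * (1 + ‖x‖) ^ 2 ∂(stdGaussian (Inp d)) := by
  rw [← integral_const_mul, ← Real.norm_eq_abs]
  refine norm_integral_le_of_norm_le ((hf.integrable 2).const_mul _) (ae_of_all _ fun x => ?_)
  have h2 : 0 ≤ ∫ θ, |θ.1| ∂μ := integral_nonneg fun θ => abs_nonneg _
  have hK := hσ.nonneg
  have h3 : (1 : ℝ) ≤ (1 + ‖x‖) ^ 2 := one_le_pow₀ (by linarith [norm_nonneg x])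
  rw [norm_mul]
  calc ‖fNN σ μ x - f x‖ * ‖σ (inner ℝ w x)‖
      ≤ ((1 + K) * (1 + ∫ θ, |θ.1| ∂μ) * (1 + |f x|)) * K :=
        mul_le_mul (hσ.abs_fNN_sub_le hμ f x) (hσ.bound _) (norm_nonneg _) (by positivity)
    _ = ((1 + K) * K * (1 + ∫ θ, |θ.1| ∂μ)) * ((1 + |f x|) * 1) := by ring
    _ ≤ ((1 + K) * K * (1 + ∫ θ, |θ.1| ∂μ)) * ((1 + |f x|) * (1 + ‖x‖) ^ 2) := by gcongr

theorem norm_residualGrad_le {f : Inp d → ℝ}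
    {μ : Measure (Param d)} (hμ : Integrable (fun θ => θ.1) μ) (w x : Inp d) :
    ‖((fNN σ μ x - f x) * deriv σ (inner ℝ w x)) • x‖ ≤ (1 + K) * K * (1 + ∫ θ, |θ.1| ∂μ) *
      ((1 + |f x|) * (1 + ‖x‖) ^ 2) := by
  have h2 : 0 ≤ ∫ θ, |θ.1| ∂μ := integral_nonneg fun θ => abs_nonneg _
  have hK := hσ.nonneg
  have h3 : ‖x‖ ≤ (1 + ‖x‖) ^ 2 := by nlinarith [norm_nonneg x]
  rw [norm_smul, norm_mul]
  calc ‖fNN σ μ x - f x‖ * ‖deriv σ (inner ℝ w x)‖ * ‖x‖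
      ≤ ((1 + K) * (1 + ∫ θ, |θ.1| ∂μ) * (1 + |f x|)) * K * (1 + ‖x‖) ^ 2 :=
        mul_le_mul (mul_le_mul (hσ.abs_fNN_sub_le hμ f x) (hσ.bound_deriv _) (norm_nonneg _)
          (by positivity)) h3 (norm_nonneg _) (by positivity)
    _ = _ := by ring

theorem integrable_residualGrad {V : Submodule ℝ (Inp d)} {f : Inp d → ℝ}
    (hf : IsSubspaceSparsePolynomial V f) {μ : Measure (Param d)} [SFinite μ]
    (hμ : Integrable (fun θ => θ.1) μ) (w : Inp d) :
    Integrable (fun x => ((fNN σ μ x - f x) * deriv σ (inner ℝ w x)) • x)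
      (stdGaussian (Inp d)) := by
  refine Integrable.mono' ((hf.integrable 2).const_mul _) ?_
    (ae_of_all _ (hσ.norm_residualGrad_le hμ w))
  have hc := hσ.continuous_deriv
  have h1 : AEStronglyMeasurable (fun x => fNN σ μ x - f x) (stdGaussian (Inp d)) :=
    ((hσ.stronglyMeasurable_fNN μ).sub hf.continuous.stronglyMeasurable).aestronglyMeasurable
  have h2 : AEStronglyMeasurable (fun x => deriv σ (inner ℝ w x)) (stdGaussian (Inp d)) :=
    Continuous.aestronglyMeasurable (by fun_prop)
  exact (h1.mul h2).smul aestronglyMeasurable_id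

theorem norm_meanResidualGrad_le {V : Submodule ℝ (Inp d)} {f : Inp d → ℝ}
    (hf : IsSubspaceSparsePolynomial V f)
    {μ : Measure (Param d)} (hμ : Integrable (fun θ => θ.1) μ) (w : Inp d) :
    ‖meanResidualGrad σ f μ w‖ ≤ (1 + K) * K * (1 + ∫ θ, |θ.1| ∂μ) *
      ∫ x, (1 + |f x|) * (1 + ‖x‖) ^ 2 ∂(stdGaussian (Inp d)) := by
  rw [← integral_const_mul]
  exact norm_integral_le_of_norm_le ((hf.integrable 2).const_mul _)
    (ae_of_all _ (hσ.norm_residualGrad_le hμ w))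

/-- Differentiation under the expectation. Since `deriv σ` is bounded, the dominating function does
not depend on `w` and serves on the whole space. -/
theorem hasGradientAt_meanResidual {V : Submodule ℝ (Inp d)} {f : Inp d → ℝ}
    (hf : IsSubspaceSparsePolynomial V f) {μ : Measure (Param d)} [SFinite μ]
    (hμ : Integrable (fun θ => θ.1) μ) (w : Inp d) :
    HasGradientAt (meanResidual σ f μ) (meanResidualGrad σ f μ w) w := by
  have hc := hσ.contDiff.continuous
  have hm : ∀ w : Inp d, AEStronglyMeasurable (fun x => (fNN σ μ x - f x) * σ (inner ℝ w x))
      (stdGaussian (Inp d)) := fun w => by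
    refine AEStronglyMeasurable.mul ?_ (Continuous.aestronglyMeasurable (by fun_prop))
    exact ((hσ.stronglyMeasurable_fNN μ).sub
      hf.continuous.stronglyMeasurable).aestronglyMeasurable
  have hK := hσ.nonneg
  have hM : 0 ≤ ∫ θ, |θ.1| ∂μ := integral_nonneg fun θ => abs_nonneg _
  have hi := hσ.integrable_residualGrad hf hμ w
  have hF : ∀ w x : Inp d, ((fNN σ μ x - f x) * deriv σ (inner ℝ w x)) • innerSL ℝ x =
      innerSL ℝ (((fNN σ μ x - f x) * deriv σ (inner ℝ w x)) • x) := fun w x => by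
    rw [map_smul]
  have key := hasFDerivAt_integral_of_dominated_of_fderiv_le (𝕜 := ℝ)
    (μ := stdGaussian (Inp d)) (s := univ) (x₀ := w)
    (F := fun w x => (fNN σ μ x - f x) * σ (inner ℝ w x))
    (F' := fun w x => ((fNN σ μ x - f x) * deriv σ (inner ℝ w x)) • innerSL ℝ x)
    (bound := fun x => (1 + K) * K * (1 + ∫ θ, |θ.1| ∂μ) * ((1 + |f x|) * (1 + ‖x‖) ^ 2))
    Filter.univ_mem (Filter.Eventually.of_forall hm) ?_ ?_ ?_ ((hf.integrable 2).const_mul _) ?_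
  · rw [hasGradientAt_iff_hasFDerivAt]
    refine key.congr_fderiv ?_
    refine (integral_congr_ae (ae_of_all _ fun x => hF w x)).trans ?_
    exact (innerSL ℝ).integral_comp_comm hi
  · refine Integrable.mono' ((hf.integrable 2).const_mul ((1 + K) * K * (1 + ∫ θ, |θ.1| ∂μ)))
      (hm w) (ae_of_all _ fun x => ?_)
    have h3 : (1 : ℝ) ≤ (1 + ‖x‖) ^ 2 := one_le_pow₀ (by linarith [norm_nonneg x])
    rw [norm_mul]
    calc ‖fNN σ μ x - f x‖ * ‖σ (inner ℝ w x)‖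
        ≤ ((1 + K) * (1 + ∫ θ, |θ.1| ∂μ) * (1 + |f x|)) * K :=
          mul_le_mul (hσ.abs_fNN_sub_le hμ f x) (hσ.bound _) (norm_nonneg _) (by positivity)
      _ = ((1 + K) * K * (1 + ∫ θ, |θ.1| ∂μ)) * ((1 + |f x|) * 1) := by ring
      _ ≤ ((1 + K) * K * (1 + ∫ θ, |θ.1| ∂μ)) * ((1 + |f x|) * (1 + ‖x‖) ^ 2) := by gcongr
  · simp only [hF]
    exact (innerSL ℝ).continuous.comp_aestronglyMeasurable hi.aestronglyMeasurable
  · refine ae_of_all _ fun x w _ => ?_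
    rw [hF, innerSL_apply_norm]
    exact hσ.norm_residualGrad_le hμ w x
  · refine ae_of_all _ fun x w _ => ?_
    have h1 : HasFDerivAt (fun w : Inp d => inner ℝ w x) (innerSL ℝ x) w := by
      have : (fun w : Inp d => inner ℝ w x) = innerSL ℝ x := by
        ext w; simp [real_inner_comm]
      rw [this]
      exact (innerSL ℝ x).hasFDerivAt
    have h2 := ((hσ.differentiable (inner ℝ w x)).hasDerivAt.comp_hasFDerivAt w h1).const_mul
      (fNN σ μ x - f x)
    rwa [smul_smul] at h2

theorem gradW_Phi {V : Submodule ℝ (Inp d)} {f : Inp d → ℝ}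
    (hf : IsSubspaceSparsePolynomial V f) {μ : Measure (Param d)} [SFinite μ]
    (hμ : Integrable (fun θ => θ.1) μ) (θ : Param d) :
    gradW (Phi σ f μ) θ = θ.1 • meanResidualGrad σ f μ θ.2 := by
  have h := (hσ.hasGradientAt_meanResidual hf hμ θ.2).hasFDerivAt.const_mul θ.1
  refine HasGradientAt.gradient ?_
  rw [hasGradientAt_iff_hasFDerivAt]
  exact h.congr_fderiv (map_smul (InnerProductSpace.toDual ℝ (Inp d)).toLinearEquiv _ _).symm

end ActivationAssumption

end

/-! ### Cancellation in the gradient along $S$. -/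

section

variable {d : ℕ}

/-- Functions that are odd under the reflection along `S` have Gaussian mean zero. -/
theorem integral_stdGaussian_eq_zero_of_odd (S : Submodule ℝ (Inp d)) {φ : Inp d → ℝ}
    (hφ : ∀ x, φ (Sᗮ.reflection x) = -φ x) : ∫ x, φ x ∂(stdGaussian (Inp d)) = 0 := by
  have h1 : ∫ x, φ x ∂(stdGaussian (Inp d)) =
      ∫ x, φ (Sᗮ.reflection x) ∂(stdGaussian (Inp d)) := by
    conv_lhs => rw [← stdGaussian_map Sᗮ.reflection]
    exact integral_map_equiv Sᗮ.reflection.toHomeomorph.toMeasurableEquiv φ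
  simp only [hφ, integral_neg] at h1
  linarith

theorem orthogonalProjectionOnto_reflection_orthogonal (S : Submodule ℝ (Inp d)) (x : Inp d) :
    (S.orthogonalProjectionOnto (Sᗮ.reflection x) : Inp d) = -S.orthogonalProjectionOnto x := by
  rw [Submodule.reflection_orthogonal_apply, Submodule.reflection_apply, map_neg, map_sub,
    two_smul, map_add]
  simp only [← Submodule.starProjection_apply]
  have h : S.orthogonalProjectionOnto (S.starProjection x) = S.orthogonalProjectionOnto x :=
    S.orthogonalProjectionOnto_mem_subspace_eq_self _
  rw [h]
  push_cast
  simp only [← Submodule.starProjection_apply]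
  module

theorem sub_orthogonalProjectionOnto_reflection_orthogonal (S : Submodule ℝ (Inp d)) (x : Inp d) :
    Sᗮ.reflection x - (S.orthogonalProjectionOnto (Sᗮ.reflection x) : Inp d) =
      x - S.orthogonalProjectionOnto x := by
  rw [orthogonalProjectionOnto_reflection_orthogonal, Submodule.reflection_orthogonal_apply,
    Submodule.reflection_apply, Submodule.starProjection_apply]
  module

theorem inner_orthogonalProjectionOnto_left (S : Submodule ℝ (Inp d)) (w x : Inp d) :
    inner ℝ (S.orthogonalProjectionOnto w : Inp d) x =
      inner ℝ w (S.orthogonalProjectionOnto x : Inp d) := by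
  simp only [← Submodule.starProjection_apply]
  exact Submodule.inner_starProjection_left_eq_right S w x

theorem inner_orthogonalProjectionOnto_right (S : Submodule ℝ (Inp d)) (w x : Inp d) :
    inner ℝ (S.orthogonalProjectionOnto w : Inp d) (S.orthogonalProjectionOnto x : Inp d) =
      inner ℝ (S.orthogonalProjectionOnto w : Inp d) x := by
  rw [← inner_orthogonalProjectionOnto_left, S.orthogonalProjectionOnto_mem_subspace_eq_self]

theorem inner_sub_orthogonalProjectionOnto (S : Submodule ℝ (Inp d)) (w x : Inp d) :
    inner ℝ w x - inner ℝ w (x - (S.orthogonalProjectionOnto x : Inp d)) =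
      inner ℝ (S.orthogonalProjectionOnto w : Inp d) x := by
  rw [inner_sub_right, inner_orthogonalProjectionOnto_left]
  ring

theorem abs_inner_le_of_norm (S : Submodule ℝ (Inp d)) (w x : Inp d) :
    |inner ℝ (S.orthogonalProjectionOnto w : Inp d) x| ≤ ‖S.orthogonalProjectionOnto w‖ * ‖x‖ :=
  abs_real_inner_le_norm _ _

/-- Arithmetic of the two errors, with `p` for $\|w_S\|$, `X` for $\|x\|$ and `F` for $|f(x)|$:
freezing $x_S$ in $\sigma'$ costs $p$, freezing it in the network costs $m$, and the pairing with
$w_S$ contributes one more factor $p$. -/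
theorem residual_bound {K R p m X F : ℝ} (hK : 0 ≤ K) (hR : 0 ≤ R) (hp : 0 ≤ p) (hm : 0 ≤ m)
    (hX : 0 ≤ X) (hF : 0 ≤ F) :
    ((1 + K) * (1 + R) * (1 + F) * (K * (p * X)) + R * (2 * K * (1 + X)) * m * K) * (p * X) ≤
      ((1 + K) * K * (1 + R) + 2 * R * K * K) * (p ^ 2 + p * m) * ((1 + F) * (1 + X) ^ 2) := by
  have hXX : X * X ≤ (1 + X) ^ 2 := by nlinarith
  have hX1 : (1 + X) * X ≤ (1 + F) * (1 + X) ^ 2 := by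
    calc (1 + X) * X ≤ 1 * (1 + X) ^ 2 := by nlinarith
      _ ≤ _ := by gcongr; linarith
  calc _ = (1 + K) * K * (1 + R) * p ^ 2 * ((1 + F) * (X * X)) +
        2 * R * K * K * (p * m) * ((1 + X) * X) := by ring
    _ ≤ (1 + K) * K * (1 + R) * p ^ 2 * ((1 + F) * (1 + X) ^ 2) +
        2 * R * K * K * (p * m) * ((1 + F) * (1 + X) ^ 2) := by gcongr
    _ ≤ _ := by
      rw [← add_mul]
      refine mul_le_mul_of_nonneg_right ?_ (by positivity)
      have h1 : 0 ≤ (1 + K) * K * (1 + R) * (p * m) := by positivity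
      have h2 : 0 ≤ 2 * R * K * K * p ^ 2 := by positivity
      linear_combination h1 + h2

namespace ActivationAssumption

variable {σ : ℝ → ℝ} {K : ℝ}

/-- A network whose neurons barely see `x_S` is nearly unchanged when `x_S` is dropped. -/
theorem abs_fNN_sub_fNN_le (hσ : ActivationAssumption σ K) (S : Submodule ℝ (Inp d))
    {μ : Measure (Param d)} [IsProbabilityMeasure μ] {R : ℝ}
    (hR : ∀ᵐ θ ∂μ, |θ.1| ≤ R) (hμ : Integrable (fun θ => θ.1) μ) (x : Inp d) :
    |fNN σ μ x - fNN σ μ (x - (S.orthogonalProjectionOnto x : Inp d))| ≤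
      R * (2 * K * (1 + ‖x‖)) * ∫ θ, min 1 ‖projS S θ‖ ∂μ := by
  rw [fNN, fNN, ← integral_sub (hσ.integrable_neuron hμ _) (hσ.integrable_neuron hμ _),
    ← integral_const_mul, ← Real.norm_eq_abs]
  refine norm_integral_le_of_norm_le ((integrable_min_one_norm_projS S μ).const_mul _) ?_
  filter_upwards [hR] with θ hθ
  have hK := hσ.nonneg
  rw [← mul_sub, norm_mul, mul_assoc]
  refine mul_le_mul hθ ?_ (norm_nonneg _) ((abs_nonneg _).trans hθ)
  have hx := norm_nonneg x
  have hp := norm_nonneg (projS S θ)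
  -- Large $w_S$: boundedness of `σ`. Small $w_S$: the Lipschitz bound. Together they give the
  -- minimum with 1.
  rcases le_total 1 ‖projS S θ‖ with h | h
  · rw [min_eq_left h, Real.norm_eq_abs]
    have h1 := abs_sub (σ (inner ℝ θ.2 x))
      (σ (inner ℝ θ.2 (x - (S.orthogonalProjectionOnto x : Inp d))))
    have h2 := hσ.bound (inner ℝ θ.2 x)
    have h3 := hσ.bound (inner ℝ θ.2 (x - (S.orthogonalProjectionOnto x : Inp d)))
    nlinarith [mul_nonneg hK hx]
  · rw [min_eq_right h, Real.norm_eq_abs]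
    refine (hσ.abs_sub_le _ _).trans ?_
    rw [inner_sub_orthogonalProjectionOnto]
    have h1 : |inner ℝ (S.orthogonalProjectionOnto θ.2 : Inp d) x| ≤ ‖projS S θ‖ * ‖x‖ :=
      abs_inner_le_of_norm S θ.2 x
    calc K * |inner ℝ (S.orthogonalProjectionOnto θ.2 : Inp d) x|
        ≤ K * (‖projS S θ‖ * ‖x‖) := mul_le_mul_of_nonneg_left h1 hK
      _ ≤ 2 * K * (1 + ‖x‖) * ‖projS S θ‖ := by
        nlinarith [mul_nonneg hK hp, mul_nonneg (mul_nonneg hK hp) hx]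

theorem integrable_target_mul_inner (hσ : ActivationAssumption σ K)
    {V : Submodule ℝ (Inp d)} {f : Inp d → ℝ} (hf : IsSubspaceSparsePolynomial V f)
    (S : Submodule ℝ (Inp d)) (v w : Inp d) :
    Integrable (fun x => f x * deriv σ (inner ℝ w (x - (S.orthogonalProjectionOnto x : Inp d))) *
      inner ℝ v x) (stdGaussian (Inp d)) := by
  have hσ' := hσ.continuous_deriv
  have hfc := hf.continuous
  have hK := hσ.nonneg
  refine Integrable.mono' ((hf.integrable 1).const_mul (K * ‖v‖))
    (Continuous.aestronglyMeasurable (by fun_prop)) (ae_of_all _ fun x => ?_)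
  rw [norm_mul, norm_mul, pow_one]
  calc ‖f x‖ * ‖deriv σ (inner ℝ w (x - (S.orthogonalProjectionOnto x : Inp d)))‖ * ‖inner ℝ v x‖
      ≤ (1 + |f x|) * K * (‖v‖ * (1 + ‖x‖)) := by
        gcongr
        · rw [Real.norm_eq_abs]; linarith
        · exact hσ.bound_deriv _
        · exact (norm_inner_le_norm v x).trans (by gcongr; linarith)
    _ = K * ‖v‖ * ((1 + |f x|) * (1 + ‖x‖)) := by ring

/-- Pair the vector-valued condition with $u_S$; by self-adjointness of the projection, $\langle
u_S,x_S\rangle=\langle u_S,x\rangle$. -/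
theorem integral_target_mul_inner_eq_zero (hσ : ActivationAssumption σ K)
    {V : Submodule ℝ (Inp d)} {f : Inp d → ℝ} (hf : IsSubspaceSparsePolynomial V f)
    (S : Submodule ℝ (Inp d)) {w : Inp d}
    (hcond : ∫ x, (f x * deriv σ (inner ℝ w (x - (S.orthogonalProjectionOnto x : Inp d)))) •
        (S.orthogonalProjectionOnto x : Inp d) ∂(stdGaussian (Inp d)) = 0) (u : Inp d) :
    ∫ x, f x * deriv σ (inner ℝ w (x - (S.orthogonalProjectionOnto x : Inp d))) *
      inner ℝ (S.orthogonalProjectionOnto u : Inp d) x ∂(stdGaussian (Inp d)) = 0 := by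
  have hσ' := hσ.continuous_deriv
  have hfc := hf.continuous
  have hK := hσ.nonneg
  have hint : Integrable (fun x =>
      (f x * deriv σ (inner ℝ w (x - (S.orthogonalProjectionOnto x : Inp d)))) •
      (S.orthogonalProjectionOnto x : Inp d)) (stdGaussian (Inp d)) := by
    refine Integrable.mono' ((hf.integrable 1).const_mul K)
      (Continuous.aestronglyMeasurable (by fun_prop)) (ae_of_all _ fun x => ?_)
    rw [norm_smul, norm_mul, pow_one]
    calc ‖f x‖ * ‖deriv σ (inner ℝ w (x - (S.orthogonalProjectionOnto x : Inp d)))‖ *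
          ‖(S.orthogonalProjectionOnto x : Inp d)‖
        ≤ (1 + |f x|) * K * (1 + ‖x‖) := by
          gcongr
          · rw [Real.norm_eq_abs]; linarith
          · exact hσ.bound_deriv _
          · exact (S.norm_orthogonalProjectionOnto_apply_le x).trans (by linarith)
      _ = K * ((1 + |f x|) * (1 + ‖x‖)) := by ring
  have h1 := integral_inner (𝕜 := ℝ) hint (S.orthogonalProjectionOnto u : Inp d)
  rw [hcond, inner_zero_right] at h1
  rw [← h1]
  refine integral_congr_ae (ae_of_all _ fun x => ?_)
  simp only [inner_smul_right, inner_orthogonalProjectionOnto_right]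

theorem integrable_network_mul_inner (hσ : ActivationAssumption σ K) (S : Submodule ℝ (Inp d))
    {μ : Measure (Param d)} [SFinite μ] (hμ : Integrable (fun θ => θ.1) μ) (v w : Inp d) :
    Integrable (fun x => fNN σ μ (x - (S.orthogonalProjectionOnto x : Inp d)) *
      deriv σ (inner ℝ w (x - (S.orthogonalProjectionOnto x : Inp d))) * inner ℝ v x)
      (stdGaussian (Inp d)) := by
  have hσ' := hσ.continuous_deriv
  have hK := hσ.nonneg
  have hM : 0 ≤ ∫ θ, |θ.1| ∂μ := integral_nonneg fun θ => abs_nonneg _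
  have h1 : AEStronglyMeasurable
      (fun x => fNN σ μ (x - (S.orthogonalProjectionOnto x : Inp d))) (stdGaussian (Inp d)) :=
    ((hσ.stronglyMeasurable_fNN μ).comp_measurable
      (Continuous.measurable (by fun_prop))).aestronglyMeasurable
  refine Integrable.mono' ((integrable_one_add_norm_pow 1).const_mul
    (K * (∫ θ, |θ.1| ∂μ) * K * ‖v‖)) ((h1.mul (Continuous.aestronglyMeasurable (by fun_prop))).mul
      (Continuous.aestronglyMeasurable (by fun_prop))) (ae_of_all _ fun x => ?_)
  simp only [norm_mul, pow_one]
  rw [mul_assoc (K * (∫ θ, |θ.1| ∂μ) * K)]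
  gcongr
  · exact hσ.abs_fNN_le hμ _
  · exact hσ.bound_deriv _
  · exact (norm_inner_le_norm v x).trans (by gcongr; linarith)

/-- The first two factors see only $x_S^\perp$, which the reflection in $S^\perp$ fixes, while the
last changes sign. -/
theorem integral_network_mul_inner_eq_zero (σ : ℝ → ℝ) (S : Submodule ℝ (Inp d))
    (μ : Measure (Param d)) (u w : Inp d) :
    ∫ x, fNN σ μ (x - (S.orthogonalProjectionOnto x : Inp d)) *
      deriv σ (inner ℝ w (x - (S.orthogonalProjectionOnto x : Inp d))) *
      inner ℝ (S.orthogonalProjectionOnto u : Inp d) x ∂(stdGaussian (Inp d)) = 0 := by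
  refine integral_stdGaussian_eq_zero_of_odd S fun x => ?_
  have h1 : inner ℝ (S.orthogonalProjectionOnto u : Inp d) (Sᗮ.reflection x) =
      -inner ℝ (S.orthogonalProjectionOnto u : Inp d) x := by
    rw [← inner_orthogonalProjectionOnto_right,
      orthogonalProjectionOnto_reflection_orthogonal, inner_neg_right,
      inner_orthogonalProjectionOnto_right]
  rw [h1, sub_orthogonalProjectionOnto_reflection_orthogonal]
  ring

/-- The integrand left after the two mean-zero terms are removed, one summand for each place where
$x$ was replaced by $x_S^\perp$. Each is of second order in $\|w_S\|$ and $m$ jointly. -/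
theorem abs_residual_split_le (hσ : ActivationAssumption σ K) (f : Inp d → ℝ)
    (S : Submodule ℝ (Inp d)) {μ : Measure (Param d)} [IsProbabilityMeasure μ] {R : ℝ}
    (hR0 : 0 ≤ R) (hR : ∀ᵐ θ ∂μ, |θ.1| ≤ R) (hμ : Integrable (fun θ => θ.1) μ) (w x : Inp d) :
    |((fNN σ μ x - f x) * (deriv σ (inner ℝ w x) -
          deriv σ (inner ℝ w (x - (S.orthogonalProjectionOnto x : Inp d)))) +
        (fNN σ μ x - fNN σ μ (x - (S.orthogonalProjectionOnto x : Inp d))) *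
          deriv σ (inner ℝ w (x - (S.orthogonalProjectionOnto x : Inp d)))) *
        inner ℝ (S.orthogonalProjectionOnto w : Inp d) x| ≤
      ((1 + K) * K * (1 + R) + 2 * R * K * K) * (‖S.orthogonalProjectionOnto w‖ ^ 2 +
          ‖S.orthogonalProjectionOnto w‖ * ∫ θ, min 1 ‖projS S θ‖ ∂μ) *
        ((1 + |f x|) * (1 + ‖x‖) ^ 2) := by
  have hK := hσ.nonneg
  have hM : ∫ θ, |θ.1| ∂μ ≤ R := by
    have := integral_mono_ae hμ.abs (integrable_const R) hR
    simpa using this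
  have hm0 : 0 ≤ ∫ θ, min 1 ‖projS S θ‖ ∂μ :=
    integral_nonneg fun θ => le_min zero_le_one (norm_nonneg _)
  have hp0 : 0 ≤ ‖S.orthogonalProjectionOnto w‖ := norm_nonneg _
  have h1 := hσ.abs_fNN_sub_le hμ f x
  have h2 := hσ.abs_deriv_sub_le (inner ℝ w x)
    (inner ℝ w (x - (S.orthogonalProjectionOnto x : Inp d)))
  rw [inner_sub_orthogonalProjectionOnto] at h2
  have h3 := hσ.abs_fNN_sub_fNN_le S hR hμ x
  have h4 := hσ.bound_deriv (inner ℝ w (x - (S.orthogonalProjectionOnto x : Inp d)))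
  have h5 := abs_inner_le_of_norm S w x
  generalize ‖S.orthogonalProjectionOnto w‖ = p at *
  generalize ∫ θ, min 1 ‖projS S θ‖ ∂μ = m at *
  generalize ∫ θ, |θ.1| ∂μ = M at *
  refine le_trans ?_ (residual_bound hK hR0 hp0 hm0 (norm_nonneg x) (abs_nonneg (f x)))
  rw [abs_mul]
  refine mul_le_mul ((abs_add_le _ _).trans (add_le_add ?_ ?_)) h5 (abs_nonneg _) (by positivity)
  · rw [abs_mul]
    refine mul_le_mul (h1.trans ?_) (h2.trans ?_) (abs_nonneg _) (by positivity)
    · gcongr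
    · gcongr
  · rw [abs_mul]
    exact mul_le_mul h3 h4 (abs_nonneg _) (by positivity)

/-- The gradient of `Φ` along `S` vanishes to first order at `w_S = 0`. -/
theorem abs_inner_meanResidualGrad_le (hσ : ActivationAssumption σ K)
    {V : Submodule ℝ (Inp d)} {f : Inp d → ℝ} (hf : IsSubspaceSparsePolynomial V f)
    (S : Submodule ℝ (Inp d))
    (hcond : ∀ w : Inp d,
      ∫ x, (f x * deriv σ (inner ℝ w (x - (S.orthogonalProjectionOnto x : Inp d)))) •
        (S.orthogonalProjectionOnto x : Inp d) ∂(stdGaussian (Inp d)) = 0)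
    {μ : Measure (Param d)} [IsProbabilityMeasure μ] {R : ℝ} (hR0 : 0 ≤ R)
    (hR : ∀ᵐ θ ∂μ, |θ.1| ≤ R) (w : Inp d) :
    |inner ℝ (S.orthogonalProjectionOnto w : Inp d) (meanResidualGrad σ f μ w)| ≤
      ((1 + K) * K * (1 + R) + 2 * R * K * K) *
        (∫ x, (1 + |f x|) * (1 + ‖x‖) ^ 2 ∂(stdGaussian (Inp d))) *
        (‖S.orthogonalProjectionOnto w‖ ^ 2 +
          ‖S.orthogonalProjectionOnto w‖ * ∫ θ, min 1 ‖projS S θ‖ ∂μ) := by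
  have hμ : Integrable (fun θ => θ.1) μ :=
    Integrable.of_bound measurable_fst.aestronglyMeasurable R hR
  have hi := hσ.integrable_residualGrad hf hμ w
  have i3 := hσ.integrable_target_mul_inner hf S (S.orthogonalProjectionOnto w : Inp d) w
  have i2 := hσ.integrable_network_mul_inner S hμ (S.orthogonalProjectionOnto w : Inp d) w
  have i1 := hi.const_inner (𝕜 := ℝ) (S.orthogonalProjectionOnto w : Inp d)
  -- Insert the frozen network and target terms, both of integral zero; the integrand becomes the
  -- one bounded in `abs_residual_split_le`.
  have e1 : inner ℝ (S.orthogonalProjectionOnto w : Inp d) (meanResidualGrad σ f μ w) =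
      ∫ x, (inner ℝ (S.orthogonalProjectionOnto w : Inp d)
          (((fNN σ μ x - f x) * deriv σ (inner ℝ w x)) • x) -
        fNN σ μ (x - (S.orthogonalProjectionOnto x : Inp d)) *
          deriv σ (inner ℝ w (x - (S.orthogonalProjectionOnto x : Inp d))) *
          inner ℝ (S.orthogonalProjectionOnto w : Inp d) x +
        f x * deriv σ (inner ℝ w (x - (S.orthogonalProjectionOnto x : Inp d))) *
          inner ℝ (S.orthogonalProjectionOnto w : Inp d) x) ∂(stdGaussian (Inp d)) := by
    refine Eq.trans ?_ (integral_add (i1.sub i2) i3).symm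
    rw [integral_sub' i1 i2, integral_network_mul_inner_eq_zero,
      hσ.integral_target_mul_inner_eq_zero hf S (hcond w), meanResidualGrad, integral_inner hi]
    ring
  rw [e1, mul_assoc, mul_comm (∫ x, _ ∂_), ← mul_assoc, ← integral_const_mul, ← Real.norm_eq_abs]
  refine norm_integral_le_of_norm_le ((hf.integrable 2).const_mul _) (ae_of_all _ fun x => ?_)
  rw [inner_smul_right, Real.norm_eq_abs]
  refine le_of_eq_of_le (congrArg _ ?_) (hσ.abs_residual_split_le f S hR0 hR hμ w x)
  ring

end ActivationAssumption

end

/-! ### Mean-field solutions as transported curves. -/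

section

variable {d : ℕ}

/-- Data are known only for $t\ge0$; freezing them at their initial value for negative times makes
them continuous on all of `ℝ`. The curve is extended in the same way below. -/
theorem LearningRateAssumption.continuous_comp_max {ξ : ℝ → ℝ} {K : ℝ}
    (hξ : LearningRateAssumption ξ K) : Continuous fun t => ξ (max t 0) := by
  obtain ⟨L, hL⟩ := hξ.lipschitz
  exact hL.continuousOn.comp_continuous (by fun_prop) fun t => le_max_right t 0

theorem LearningRateAssumption.abs_comp_max_le {ξ : ℝ → ℝ} {K : ℝ}
    (hξ : LearningRateAssumption ξ K) (t : ℝ) : |ξ (max t 0)| ≤ K := by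
  rw [abs_of_nonneg (hξ.nonneg _ (le_max_right t 0))]
  exact hξ.bound _ (le_max_right t 0)

section Measurability

variable {ρ : ℝ → ProbabilityMeasure (Param d)} (hc : Continuous ρ) {σ : ℝ → ℝ} {K : ℝ}
  (hσ : ActivationAssumption σ K)
include hc

theorem stronglyMeasurable_integral_curve {X : Type*} [MeasurableSpace X]
    {F : (ℝ × X) → Param d → ℝ}
    (hF : Measurable (Function.uncurry F)) :
    StronglyMeasurable fun q : ℝ × X => ∫ θ, F q θ ∂(ρ q.1 : Measure (Param d)) := by
  let κ : Kernel (ℝ × X) (Param d) :=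
    ⟨fun q => (ρ q.1 : Measure (Param d)),
      (measurable_toMeasure_of_continuous hc).comp measurable_fst⟩
  have : IsMarkovKernel κ :=
    ⟨fun q => inferInstanceAs (IsProbabilityMeasure (ρ q.1 : Measure (Param d)))⟩
  exact StronglyMeasurable.integral_kernel_prod_right (κ := κ) hF.stronglyMeasurable

include hσ

theorem stronglyMeasurable_fNN_curve :
    StronglyMeasurable fun q : ℝ × Inp d => fNN σ (ρ q.1 : Measure (Param d)) q.2 := by
  have hσc := hσ.contDiff.continuous
  refine stronglyMeasurable_integral_curve hc
    (F := fun (q : ℝ × Inp d) (θ : Param d) => θ.1 * σ (inner ℝ θ.2 q.2)) ?_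
  exact Continuous.measurable (by fun_prop)

theorem measurable_meanResidual_curve {f : Inp d → ℝ} (hf : Continuous f) :
    Measurable fun q : ℝ × Inp d => meanResidual σ f (ρ q.1 : Measure (Param d)) q.2 := by
  have hσc := hσ.contDiff.continuous
  refine (StronglyMeasurable.integral_prod_right (f := fun (q : ℝ × Inp d) (x : Inp d) =>
    (fNN σ (ρ q.1 : Measure (Param d)) x - f x) * σ (inner ℝ q.2 x)) ?_).measurable
  have h1 : StronglyMeasurable fun z : (ℝ × Inp d) × Inp d =>
      fNN σ (ρ z.1.1 : Measure (Param d)) z.2 :=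
    (stronglyMeasurable_fNN_curve hc hσ).comp_measurable
      (measurable_fst.fst.prodMk measurable_snd)
  exact (h1.sub (Continuous.stronglyMeasurable (by fun_prop))).mul
    (Continuous.stronglyMeasurable (by fun_prop))

theorem measurable_meanResidualGrad_curve {f : Inp d → ℝ} (hf : Continuous f) :
    Measurable fun q : ℝ × Inp d => meanResidualGrad σ f (ρ q.1 : Measure (Param d)) q.2 := by
  have hσc := hσ.continuous_deriv
  refine (StronglyMeasurable.integral_prod_right (f := fun (q : ℝ × Inp d) (x : Inp d) =>
    ((fNN σ (ρ q.1 : Measure (Param d)) x - f x) * deriv σ (inner ℝ q.2 x)) • x) ?_).measurable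
  have h1 : StronglyMeasurable fun z : (ℝ × Inp d) × Inp d =>
      fNN σ (ρ z.1.1 : Measure (Param d)) z.2 :=
    (stronglyMeasurable_fNN_curve hc hσ).comp_measurable
      (measurable_fst.fst.prodMk measurable_snd)
  exact ((h1.sub (Continuous.stronglyMeasurable (by fun_prop))).mul
    (Continuous.stronglyMeasurable (by fun_prop))).smul
    (Continuous.stronglyMeasurable (by fun_prop))

end Measurability

namespace IsMeanFieldSolution

variable {σ : ℝ → ℝ} {f : Inp d → ℝ} {ξa ξw : ℝ → ℝ} {ρ₀ : Measure (Param d)}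
  {ρ : ℝ → ProbabilityMeasure (Param d)}

theorem continuous_comp_max (hρ : IsMeanFieldSolution σ f ξa ξw ρ₀ ρ) :
    Continuous fun t => ρ (max t 0) :=
  hρ.continuousOn.comp_continuous (by fun_prop) fun t => le_max_right t 0

theorem measurable_lintegral_enorm_fst (hρ : IsMeanFieldSolution σ f ξa ξw ρ₀ ρ) :
    Measurable fun t => ∫⁻ θ, ‖θ.1‖ₑ ∂(ρ (max t 0) : Measure (Param d)) :=
  (Measure.measurable_lintegral measurable_fst.enorm).comp
    (measurable_toMeasure_of_continuous hρ.continuous_comp_max)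

theorem lintegral_lintegral_enorm_fst_ne_top (hρ : IsMeanFieldSolution σ f ξa ξw ρ₀ ρ) (T : ℝ) :
    ∫⁻ t in Ioc 0 T, ∫⁻ θ, ‖θ.1‖ₑ ∂(ρ (max t 0) : Measure (Param d)) ≠ ⊤ := by
  refine ne_of_lt (lt_of_eq_of_lt ?_ (hρ.integrable T))
  refine setLIntegral_congr_fun measurableSet_Ioc fun t ht => ?_
  simp only [max_eq_left ht.1.le]

theorem integrableOn_integral_abs_fst (hρ : IsMeanFieldSolution σ f ξa ξw ρ₀ ρ) (T : ℝ) :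
    IntegrableOn (fun t => ∫ θ, |θ.1| ∂(ρ (max t 0) : Measure (Param d))) (Ioc 0 T) := by
  refine (integrable_toReal_of_lintegral_ne_top hρ.measurable_lintegral_enorm_fst.aemeasurable
    (hρ.lintegral_lintegral_enorm_fst_ne_top T)).congr (ae_of_all _ fun t => ?_)
  exact (integral_norm_eq_lintegral_enorm measurable_fst.aestronglyMeasurable).symm

/-- A finite integral over each `(0, n]` has an almost everywhere finite integrand. At these times
the network is given by an absolutely convergent integral and the gradient formulas hold. -/
theorem ae_integrable_fst (hρ : IsMeanFieldSolution σ f ξa ξw ρ₀ ρ) :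
    ∀ᵐ t ∂volume.restrict (Ioi (0 : ℝ)),
      Integrable (fun θ => θ.1) (ρ (max t 0) : Measure (Param d)) := by
  have hU : Ioi (0 : ℝ) = ⋃ n : ℕ, Ioc (0 : ℝ) n := by
    ext t
    simp only [mem_Ioi, mem_iUnion, mem_Ioc, exists_and_left, iff_self_and]
    exact fun _ => exists_nat_ge t
  rw [hU, ae_restrict_iUnion_iff]
  intro n
  filter_upwards [ae_lt_top hρ.measurable_lintegral_enorm_fst
    (hρ.lintegral_lintegral_enorm_fst_ne_top n)] with t ht
  exact ⟨measurable_fst.aestronglyMeasurable, ht⟩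

/-- A mean-field solution is transported by its own gradient field. -/
theorem isTransportedBy (hρ : IsMeanFieldSolution σ f ξa ξw ρ₀ ρ) {V : Submodule ℝ (Inp d)}
    (hf : IsSubspaceSparsePolynomial V f) {Kσ Kξ : ℝ} (hσ : ActivationAssumption σ Kσ)
    (hξa : LearningRateAssumption ξa Kξ) (hξw : LearningRateAssumption ξw Kξ) :
    IsTransportedBy (fun t => ρ (max t 0))
      (fun t θ => ξa (max t 0) * meanResidual σ f (ρ (max t 0) : Measure (Param d)) θ.2)
      (fun t θ => ξw (max t 0) •
        (θ.1 • meanResidualGrad σ f (ρ (max t 0) : Measure (Param d)) θ.2))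
      (fun t => Kξ * ((1 + Kσ) * Kσ * (1 + ∫ θ, |θ.1| ∂(ρ (max t 0) : Measure (Param d))) *
        ∫ x, (1 + |f x|) * (1 + ‖x‖) ^ 2 ∂(stdGaussian (Inp d)))) := by
  have hc := hρ.continuous_comp_max
  have hKσ := hσ.nonneg
  have hKξ : 0 ≤ Kξ := (abs_nonneg _).trans (hξa.abs_comp_max_le 0)
  have hproj : Measurable fun q : ℝ × Param d => (q.1, q.2.2) :=
    measurable_fst.prodMk measurable_snd.snd
  refine ⟨hc, ?_, ?_, fun T => ?_, fun t => ?_, ?_, ?_, fun η hη => ?_⟩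
  · exact (hξa.continuous_comp_max.measurable.comp measurable_fst).mul
      ((measurable_meanResidual_curve hc hσ hf.continuous).comp hproj)
  · exact (hξw.continuous_comp_max.measurable.comp measurable_fst).smul
      (measurable_snd.fst.smul ((measurable_meanResidualGrad_curve hc hσ hf.continuous).comp hproj))
  -- The first moment of `a` is known only to be integrable in time, which is why the velocity bound
  -- is a function of time and not a constant.
  · exact ((((integrable_const (1 : ℝ)).add
      (hρ.integrableOn_integral_abs_fst T)).const_mul _).mul_const _).const_mul _
  · have h1 : 0 ≤ ∫ θ, |θ.1| ∂(ρ (max t 0) : Measure (Param d)) :=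
      integral_nonneg fun θ => abs_nonneg _
    have h2 : 0 ≤ ∫ x, (1 + |f x|) * (1 + ‖x‖) ^ 2 ∂(stdGaussian (Inp d)) :=
      integral_nonneg fun x => by positivity
    positivity
  · filter_upwards [hρ.ae_integrable_fst] with t ht θ
    rw [abs_mul]
    exact mul_le_mul (hξa.abs_comp_max_le t) (hσ.abs_meanResidual_le hf ht θ.2) (abs_nonneg _) hKξ
  · filter_upwards [hρ.ae_integrable_fst] with t ht θ
    rw [norm_smul, norm_smul, Real.norm_eq_abs, Real.norm_eq_abs, mul_left_comm]
    exact mul_le_mul_of_nonneg_left (mul_le_mul (hξw.abs_comp_max_le t)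
      (hσ.norm_meanResidualGrad_le hf ht θ.2) (norm_nonneg _) hKξ) (abs_nonneg _)
  · refine Eq.trans (setIntegral_congr_ae measurableSet_Ioi ?_) (hρ.weak η hη)
    have h := hρ.ae_integrable_fst
    rw [ae_restrict_iff' measurableSet_Ioi] at h
    filter_upwards [h] with t ht ht0
    have hμ := ht ht0
    rw [max_eq_left (le_of_lt ht0)] at hμ ⊢
    refine integral_congr_ae (ae_of_all _ fun θ => ?_)
    simp only [derivA_Phi, hσ.gradW_Phi hf hμ, inner_smul_right]
    ring

end IsMeanFieldSolution

end

theorem theorem3p4 (d : ℕ)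
    (V : Submodule ℝ (Inp d)) (f : Inp d → ℝ) (hf : IsSubspaceSparsePolynomial V f)
    (σ ξa ξw : ℝ → ℝ) (Kσ Kξ Kρ : ℝ) (hKσ : 0 < Kσ) (hKξ : 0 < Kξ) (hKρ : 0 < Kρ)
    (hσ : ActivationAssumption σ Kσ)
    (hξa : LearningRateAssumption ξa Kξ) (hξw : LearningRateAssumption ξw Kξ)
    (ρ₀ : MeasureTheory.Measure (Param d)) (hρ₀ : InitialAssumption ρ₀ Kρ)
    (ρ : ℝ → MeasureTheory.ProbabilityMeasure (Param d))
    (hρ : IsMeanFieldSolution σ f ξa ξw ρ₀ ρ)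
    (S : Submodule ℝ (Inp d))
    (hS : ρ₀.map (projS S) = MeasureTheory.Measure.dirac (0 : S))
    (hcond : ∀ w : Inp d,
      ∫ x, (f x * deriv σ (inner ℝ w (x - (S.orthogonalProjectionOnto x : Inp d)))) •
        (S.orthogonalProjectionOnto x : Inp d) ∂(ProbabilityTheory.stdGaussian (Inp d)) = 0) :
    ∀ t : ℝ, 0 ≤ t →
      (ρ t : MeasureTheory.Measure (Param d)).map (projS S) =
        MeasureTheory.Measure.dirac (0 : S) := by
  intro t ht
  have hT := hρ.isTransportedBy hf hσ hξa hξw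
  have hinit : (ρ (max 0 0) : Measure (Param d)) = ρ₀ := by rw [max_self, hρ.initial]
  have hmeas : Measurable (projS S) := (continuous_projS S).measurable
  have h0 : ∀ᵐ θ ∂(ρ (max 0 0) : Measure (Param d)), |θ.1| ≤ Kρ := by
    rw [hinit]
    obtain ⟨ρa, ρw, _, _, rfl, -, hsupp⟩ := hρ₀
    have h1 : ∀ᵐ a ∂ρa, |a| ≤ Kρ := by
      rw [ae_iff]
      refine measure_mono_null (fun a ha => ?_) hsupp
      exact fun h => ha (abs_le.2 h)
    exact Measure.quasiMeasurePreserving_fst.ae h1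
  have h0S : ∀ᵐ θ ∂(ρ (max 0 0) : Measure (Param d)), projS S θ = 0 := by
    rw [hinit]
    have h1 : ∀ᵐ z ∂ρ₀.map (projS S), z = 0 := by
      rw [hS]
      exact (ae_dirac_iff (p := fun z : S => z = 0) (measurableSet_singleton 0)).2 rfl
    exact ae_of_ae_map hmeas.aemeasurable h1
  have hβ := hT.ae_projS_eq_zero h0 S h0S (fun R hR0 => ?_) ht
  · rw [max_eq_left ht] at hβ
    rw [Measure.map_congr (show projS S =ᵐ[(ρ t : Measure (Param d))] fun _ => 0 from hβ),
      Measure.map_const]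
    simp
  · have hK := hσ.nonneg
    have hE : 0 ≤ ∫ x, (1 + |f x|) * (1 + ‖x‖) ^ 2 ∂(stdGaussian (Inp d)) :=
      integral_nonneg fun x => by positivity
    -- The learning-rate bound times the constant of `abs_inner_meanResidualGrad_le`; it depends on
    -- the solution only through `R`.
    refine ⟨Kξ * (((1 + Kσ) * Kσ * (1 + R) + 2 * R * Kσ * Kσ) *
      ∫ x, (1 + |f x|) * (1 + ‖x‖) ^ 2 ∂(stdGaussian (Inp d))), by positivity,
      ae_of_all _ fun r hr θ => ?_⟩
    have h1 := hσ.abs_inner_meanResidualGrad_le hf S hcond hR0 hr θ.2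
    rw [inner_smul_right, inner_smul_right, abs_mul, abs_mul, mul_left_comm, mul_assoc Kξ]
    exact mul_le_mul_of_nonneg_left (mul_le_mul (hξw.abs_comp_max_le r) h1 (abs_nonneg _) hKξ.le)
      (abs_nonneg _)
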